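/- Let $k$ be an arbitrary field, let $S=k[x_1,\ldots,x_n]$, and let $M\subseteq S$ be a monomial ideal with minimal generating set of monomials $G$. A monomial $m\in G$ is called dominant if there is a variable $x$ such that, for all $m'\in G\setminus\{m\}$, the exponent of $x$ in $m$ is larger than the exponent of $x$ in $m'$. The ideal $M$ is called $2$-semidominant if exactly two elements of $G$ are not dominant. The basis elements (Taylor symbols) $[\sigma]$ of the Taylor resolution $\mathbb{T}_M$ of $S/M$ correspond to the subsets $\sigma\subseteq G$, with homological degree $\operatorname{hdeg}[\sigma]=\#\sigma$ and multidegree $\operatorname{mdeg}[\sigma]=\operatorname{lcm}(\sigma)$ (where $\operatorname{lcm}(\varnothing)=1$). For $i\ge 0$ and a monomial $l$, let $\mathrm{b}_{i,l}(S/M)$ be the multigraded Betti number of $S/M$, that is, the number of basis elements of multidegree $l$ in homological degree $i$ of a minimal multigraded free resolution of $S/M$. Let $L$ be the set of all monomials $l$ such that the number of Taylor symbols of $\mathbb{T}_M$ with multidegree $l$ is odd, and for $l\in L$ let \[f(l)=\min\{\operatorname{hdeg}[\sigma] : [\sigma]\in\mathbb{T}_M,\ \operatorname{mdeg}[\sigma]=l\}.\]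 **Theorem.** If $M$ is $2$-semidominant, then $M$ has characteristic Betti numbers in minimal homological degrees; that is, for all $i\ge 0$ and all monomials $l$, \[\mathrm{b}_{i,l}(S/M)=\begin{cases}1 & \text{if } l\in L \text{ and } i=f(l),\\ 0 & \text{otherwise.}\end{cases}\] -/

import Mathlib

/-! Monomials of `S = k[x_s : s ∈ σ]` are identified with their exponent vectors `a : σ →₀ ℕ`.
Divisibility is then the pointwise order `≤` and `lcm` is the pointwise supremum `⊔`. -/

namespace MonomialIdeal

variable {σ k : Type*} [Field k]

/-- `M` is generated by monomials. -/
def IsMonomialIdeal (M : Ideal (MvPolynomial σ k)) : Prop :=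
  ∃ A : Set (σ →₀ ℕ), M = Ideal.span ((fun a => MvPolynomial.monomial a (1 : k)) '' A)

theorem finite_minimal_monomials [Finite σ] (M : Ideal (MvPolynomial σ k)) :
    {a : σ →₀ ℕ | Minimal (fun b => MvPolynomial.monomial b (1 : k) ∈ M) a}.Finite :=
  WellQuasiOrderedLE.finite_of_isAntichain (setOfPred_minimal_antichain _)

/-- The minimal generating set `G` of a monomial ideal `M`: the monomials of `M` that are minimal
with respect to divisibility. -/
noncomputable def minimalGenerators [Finite σ] (M : Ideal (MvPolynomial σ k)) :
    Finset (σ →₀ ℕ) :=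
  (finite_minimal_monomials M).toFinset

/-- The minimal generating set does generate the ideal. -/
theorem span_minimalGenerators [Finite σ] {M : Ideal (MvPolynomial σ k)}
    (hM : IsMonomialIdeal M) :
    Ideal.span ((fun a => MvPolynomial.monomial a (1 : k)) '' (minimalGenerators M)) = M := by
  apply le_antisymm
  · rw [Ideal.span_le]
    rintro _ ⟨a, ha, rfl⟩
    have ha' : Minimal (fun b => MvPolynomial.monomial b (1 : k) ∈ M) a := by
      simpa [minimalGenerators] using ha
    exact ha'.1
  · obtain ⟨A, hA⟩ := hM
    intro p hp
    rw [hA, MvPolynomial.mem_ideal_span_monomial_image] at hp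
    rw [MvPolynomial.mem_ideal_span_monomial_image]
    intro x hx
    obtain ⟨a, ha, hax⟩ := hp x hx
    have haM : MvPolynomial.monomial a (1 : k) ∈ M := by
      rw [hA]; exact Ideal.subset_span ⟨a, ha, rfl⟩
    obtain ⟨b, hba, hb⟩ := exists_minimal_le_of_wellFoundedLT
      (fun b => MvPolynomial.monomial b (1 : k) ∈ M) a haM
    exact ⟨b, by simpa [minimalGenerators] using hb, hba.trans hax⟩

/-- `m` is dominant in `G`: some variable has a larger exponent in `m` than in every other
element of `G`. -/
def IsDominant (G : Finset (σ →₀ ℕ)) (m : σ →₀ ℕ) : Prop :=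
  ∃ x : σ, ∀ m' ∈ G, m' ≠ m → m' x < m x

open Classical in
/-- `M` is `p`-semidominant: exactly `p` of its minimal generators are nondominant. -/
def IsSemidominant [Finite σ] (p : ℕ) (M : Ideal (MvPolynomial σ k)) : Prop :=
  ((minimalGenerators M).filter fun m => ¬ IsDominant (minimalGenerators M) m).card = p

open Classical in
/-- The Taylor symbols of multidegree `l`, that is, the basis elements of multidegree `l` of the
Taylor resolution of `S/M` on the minimal generators of `M`: the sets of minimal generators whose
`lcm` is `l`. The homological degree of a Taylor symbol is its cardinality. -/
noncomputable def taylorSymbols [Finite σ] (M : Ideal (MvPolynomial σ k)) (l : σ →₀ ℕ) :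
    Finset (Finset (σ →₀ ℕ)) :=
  (minimalGenerators M).powerset.filter fun s => s.sup id = l

/-- The set `L` of monomials that are the multidegree of an odd number of Taylor symbols. -/
def oddMultidegrees [Finite σ] (M : Ideal (MvPolynomial σ k)) : Set (σ →₀ ℕ) :=
  {l | Odd (taylorSymbols M l).card}

/-- `f(l)`: the least homological degree of a Taylor symbol of multidegree `l`. It is only used
for `l ∈ L`, where such a symbol exists. -/
noncomputable def minHomologicalDegree [Finite σ] (M : Ideal (MvPolynomial σ k))
    (l : σ →₀ ℕ) : ℕ :=
  sInf {i | ∃ s ∈ taylorSymbols M l, s.card = i}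

/-- A multigraded free resolution `⋯ ⟶ F₁ ⟶ F₀ ⟶ S/M ⟶ 0` by finitely generated free modules
with multihomogeneous bases. Here `F i` is free on the basis `ι i`, the map `F (i+1) ⟶ F i` is
`d i` and the map `F 0 ⟶ S/M` is `aug`. -/
structure MultigradedFreeResolution (M : Ideal (MvPolynomial σ k)) where
  ι : ℕ → Type
  finite_ι : ∀ i, Finite (ι i)
  mdeg : ∀ i, ι i → (σ →₀ ℕ)
  d : ∀ i, (ι (i + 1) →₀ MvPolynomial σ k) →ₗ[MvPolynomial σ k] (ι i →₀ MvPolynomial σ k)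
  aug : (ι 0 →₀ MvPolynomial σ k) →ₗ[MvPolynomial σ k] (MvPolynomial σ k ⧸ M)
  /-- The matrix entry at `(b', b)` is a scalar multiple of `x ^ (mdeg b - mdeg b')`, and is zero
  if `x ^ mdeg b'` does not divide `x ^ mdeg b`. -/
  d_homogeneous : ∀ i (b : ι (i + 1)) (b' : ι i), ∃ c : k,
    d i (Finsupp.single b 1) b' * MvPolynomial.monomial (mdeg i b') 1 =
      MvPolynomial.monomial (mdeg (i + 1) b) c
  aug_homogeneous : ∀ b : ι 0, ∃ c : k,
    aug (Finsupp.single b 1) = Ideal.Quotient.mk M (MvPolynomial.monomial (mdeg 0 b) c)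
  aug_surjective : Function.Surjective aug
  exact_zero : Function.Exact (d 0) aug
  exact_succ : ∀ i, Function.Exact (d (i + 1)) (d i)

/-- No differential matrix `F (i+1) ⟶ F i` has an invertible entry. -/
def MultigradedFreeResolution.IsMinimal {M : Ideal (MvPolynomial σ k)}
    (F : MultigradedFreeResolution M) : Prop :=
  ∀ i (b : F.ι (i + 1)) (b' : F.ι i), ¬ IsUnit (F.d i (Finsupp.single b 1) b')

/-- The number of basis elements in homological degree `i` and multidegree `l`. -/
noncomputable def MultigradedFreeResolution.count {M : Ideal (MvPolynomial σ k)}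
    (F : MultigradedFreeResolution M) (i : ℕ) (l : σ →₀ ℕ) : ℕ :=
  Nat.card {b : F.ι i // F.mdeg i b = l}

/-- The multigraded Betti numbers of `S/M` are `β i l`: a minimal multigraded free resolution of
`S/M` exists, and each one has exactly `β i l` basis elements of homological degree `i` and
multidegree `l`. -/
def HasMultigradedBettiNumbers (M : Ideal (MvPolynomial σ k)) (β : ℕ → (σ →₀ ℕ) → ℕ) : Prop :=
  (∃ F : MultigradedFreeResolution M, F.IsMinimal) ∧
    ∀ F : MultigradedFreeResolution M, F.IsMinimal → ∀ i l, F.count i l = β i l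

open Classical in
/-- `M` has characteristic Betti numbers in minimal homological degrees: the Betti number in
homological degree `i` and multidegree `l` is `1` if `l ∈ L` and `i = f(l)`, and `0` otherwise. -/
def HasCharacteristicBettiNumbersInMinimalHomologicalDegrees [Finite σ]
    (M : Ideal (MvPolynomial σ k)) : Prop :=
  HasMultigradedBettiNumbers M fun i l =>
    if l ∈ oddMultidegrees M ∧ i = minHomologicalDegree M l then 1 else 0

end MonomialIdeal

-- Given a graded resolution of `S/M` and a degree `l`, divide the strand of degree `l` by the part
-- that comes from smaller degrees. The homology of this complex is the degree `l` part of
-- `Tor_i(S/M, k)`, so it does not depend on the resolution. For a minimal resolution the induced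
-- differential is zero, and the homology counts the cells of degree `l`; for the Taylor resolution
-- the complex is spanned by the Taylor symbols with lcm `l`. `exists_graded_comparison` gives this
-- comparison with elements and homotopies, without forming quotients.
--
-- A dominant generator belongs to every set of generators whose lcm it divides
-- (`IsDominant.mem_of_le_sup`). Hence the sets with lcm `l` have the same dominant members and lie
-- among `t`, `t ∪ {p}`, `t ∪ {q}`, `t ∪ {p, q}`, where `p` and `q` are the nondominant generators.
-- By `toggle_or_unique_or_triple` these sets come in pairs differing by one generator, or there is
-- only one, or they are the last three. In the first case their number is even and a cone kills the
-- homology. Otherwise their number is 1 or 3 and the homology is one-dimensional, in the least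
-- cardinality that occurs.
--
-- A minimal resolution is built from successive minimal covers of syzygies
-- (`StrandResolution.exists_minimal`). These arguments take place over `k`, strand by strand;
-- dehomogenization translates to and from modules over the polynomial ring.

universe u v w w'

/-! ### Free modules filtered by the degrees of their cells -/

section Strands

variable {k : Type u} [Field k] {P : Type v} [PartialOrder P] {J : Type w}

/-- The span of the active cells of degree at most `a`. -/
def degreeLE (k : Type u) [Field k] (C : Set J) (deg : J → P) (a : P) : Submodule k (J →₀ k) :=
  Finsupp.supported k k {b | b ∈ C ∧ deg b ≤ a}

/-- The span of the active cells of degree less than `a`. -/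
def degreeLT (k : Type u) [Field k] (C : Set J) (deg : J → P) (a : P) : Submodule k (J →₀ k) :=
  Finsupp.supported k k {b | b ∈ C ∧ deg b < a}

theorem mem_degreeLE {C : Set J} {deg : J → P} {a : P} {x : J →₀ k} :
    x ∈ degreeLE k C deg a ↔ ∀ b, x b ≠ 0 → b ∈ C ∧ deg b ≤ a := by
  simp [degreeLE, Finsupp.mem_supported, Set.subset_def]

theorem mem_degreeLT {C : Set J} {deg : J → P} {a : P} {x : J →₀ k} :
    x ∈ degreeLT k C deg a ↔ ∀ b, x b ≠ 0 → b ∈ C ∧ deg b < a := by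
  simp [degreeLT, Finsupp.mem_supported, Set.subset_def]

theorem degreeLE_mono (C : Set J) (deg : J → P) : Monotone (degreeLE k C deg) :=
  fun _ _ h => Finsupp.supported_mono fun _ hb => ⟨hb.1, hb.2.trans h⟩

theorem degreeLT_mono (C : Set J) (deg : J → P) : Monotone (degreeLT k C deg) :=
  fun _ _ h => Finsupp.supported_mono fun _ hb => ⟨hb.1, hb.2.trans_le h⟩

theorem degreeLT_le_degreeLE (C : Set J) (deg : J → P) (a : P) :
    degreeLT k C deg a ≤ degreeLE k C deg a :=
  Finsupp.supported_mono fun _ hb => ⟨hb.1, hb.2.le⟩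

theorem degreeLE_le_degreeLT (C : Set J) (deg : J → P) {a b : P} (h : a < b) :
    degreeLE k C deg a ≤ degreeLT k C deg b :=
  Finsupp.supported_mono fun _ hb => ⟨hb.1, hb.2.trans_lt h⟩

theorem single_mem_degreeLE {C : Set J} {deg : J → P} {a : P} {b : J} (hb : b ∈ C)
    (h : deg b ≤ a) (c : k) : Finsupp.single b c ∈ degreeLE k C deg a :=
  Finsupp.single_mem_supported k c ⟨hb, h⟩

theorem mem_degreeLT_iff {C : Set J} {deg : J → P} {a : P} {x : J →₀ k}
    (hx : x ∈ degreeLE k C deg a) :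
    x ∈ degreeLT k C deg a ↔ ∀ b ∈ C, deg b = a → x b = 0 := by
  rw [mem_degreeLT]
  rw [mem_degreeLE] at hx
  constructor
  · intro h b _ hb
    by_contra hne
    exact (h b hne).2.ne hb
  · intro h b hne
    obtain ⟨h1, h2⟩ := hx b hne
    exact ⟨h1, lt_of_le_of_ne h2 fun e => hne (h b h1 e)⟩

/-- To check that a linear map sends a span of cells into a submodule, check the cells. -/
theorem map_mem_of_single {W : Type*} [AddCommGroup W] [Module k W] {A : Set J}
    (φ : (J →₀ k) →ₗ[k] W) (N : Submodule k W)
    (h : ∀ b ∈ A, φ (Finsupp.single b 1) ∈ N) {x : J →₀ k} (hx : x ∈ Finsupp.supported k k A) :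
    φ x ∈ N := by
  rw [Finsupp.supported_eq_span_single] at hx
  have : Submodule.span k ((fun i => Finsupp.single i (1 : k)) '' A) ≤ N.comap φ := by
    rw [Submodule.span_le]
    rintro _ ⟨b, hb, rfl⟩
    exact h b hb
  exact this hx

/-- Two linear maps that agree on cells agree on their span. -/
theorem map_eq_of_single {W : Type*} [AddCommGroup W] [Module k W] {A : Set J}
    (φ ψ : (J →₀ k) →ₗ[k] W)
    (h : ∀ b ∈ A, φ (Finsupp.single b 1) = ψ (Finsupp.single b 1)) {x : J →₀ k}
    (hx : x ∈ Finsupp.supported k k A) : φ x = ψ x := by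
  have := map_mem_of_single (φ - ψ) ⊥ (fun b hb => by simp [h b hb]) hx
  simpa [sub_eq_zero] using this

/-- A cell of degree less than `a` is mapped into the span of degree at most its own degree, which
is still less than `a`. -/
theorem map_degreeLT_of_map_degreeLE {J' : Type w'} {C : Set J} {deg : J → P} {C' : Set J'}
    {deg' : J' → P} {f : (J →₀ k) →ₗ[k] (J' →₀ k)}
    (hf : ∀ a, ∀ x ∈ degreeLE k C deg a, f x ∈ degreeLE k C' deg' a) {a : P} {x : J →₀ k}
    (hx : x ∈ degreeLT k C deg a) : f x ∈ degreeLT k C' deg' a :=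
  map_mem_of_single f _ (fun b hb => degreeLE_le_degreeLT _ _ hb.2
    (hf (deg b) _ (single_mem_degreeLE hb.1 le_rfl 1))) hx

/-- Maps out of a filtered free module lift along filtered surjections. -/
theorem exists_filtered_lift {V W : Type*} [AddCommGroup V] [Module k V] [AddCommGroup W]
    [Module k W] (C : Set J) (deg : J → P) {F : P → Submodule k V} (hF : Monotone F)
    (D : V →ₗ[k] W) (φ : (J →₀ k) →ₗ[k] W)
    (h : ∀ b ∈ C, ∃ y ∈ F (deg b), D y = φ (Finsupp.single b 1)) :
    ∃ f : (J →₀ k) →ₗ[k] V, (∀ a, ∀ x ∈ degreeLE k C deg a, f x ∈ F a) ∧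
      ∀ a, ∀ x ∈ degreeLE k C deg a, D (f x) = φ x := by
  classical
  choose! y hy hDy using h
  refine ⟨Finsupp.linearCombination k y, fun a x hx => ?_, fun a x hx => ?_⟩
  · refine map_mem_of_single _ _ (fun b hb => ?_) hx
    simpa using hF hb.2 (hy b hb.1)
  · refine map_eq_of_single (D ∘ₗ Finsupp.linearCombination k y) φ (fun b hb => ?_) hx
    simpa using hDy b hb.1

/-- Dependent choice. Chain maps, homotopies and minimal resolutions are built with it; the
invariant needed to continue is carried by the type `A i`. -/
theorem exists_dependent_sequence {A : ℕ → Type*} (r : ∀ i, A i → A (i + 1) → Prop) (a : A 0)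
    (h : ∀ i x, ∃ y, r i x y) : ∃ f : ∀ i, A i, f 0 = a ∧ ∀ i, r i (f i) (f (i + 1)) := by
  choose g hg using h
  exact ⟨fun i => Nat.rec a g i, rfl, fun i => hg i _⟩

end Strands

/-! ### Comparison of graded resolutions -/

/-- The strands of a multigraded free resolution of the quotient by the monomial ideal with set of
monomials `U`: the strand of degree `a` is spanned by the active cells of degree at most `a`, and
resolves `0` if `a ∈ U` and `k` otherwise. -/
structure StrandResolution (k : Type u) [Field k] {P : Type v} [PartialOrder P] [OrderBot P]
    (U : Set P) where
  cell : ℕ → Type w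
  active : ∀ i, Set (cell i)
  deg : ∀ i, cell i → P
  D : ∀ i, (cell (i + 1) →₀ k) →ₗ[k] (cell i →₀ k)
  aug : (cell 0 →₀ k) →ₗ[k] k
  D_mem : ∀ i a, ∀ x ∈ degreeLE k (active (i + 1)) (deg (i + 1)) a,
    D i x ∈ degreeLE k (active i) (deg i) a
  D_D : ∀ i a, ∀ x ∈ degreeLE k (active (i + 2)) (deg (i + 2)) a, D i (D (i + 1) x) = 0
  aug_D : ∀ a ∉ U, ∀ x ∈ degreeLE k (active 1) (deg 1) a, aug (D 0 x) = 0
  exact_succ : ∀ i a, ∀ x ∈ degreeLE k (active (i + 1)) (deg (i + 1)) a, D i x = 0 →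
    ∃ y ∈ degreeLE k (active (i + 2)) (deg (i + 2)) a, D (i + 1) y = x
  exact_zero : ∀ a, ∀ x ∈ degreeLE k (active 0) (deg 0) a, (a ∈ U ∨ aug x = 0) →
    ∃ y ∈ degreeLE k (active 1) (deg 1) a, D 0 y = x
  exists_aug_eq_one : ∃ x ∈ degreeLE k (active 0) (deg 0) ⊥, aug x = 1

namespace StrandResolution

variable {k : Type u} [Field k] {P : Type v} [PartialOrder P] [OrderBot P] {U : Set P}

/-- The strand of degree `a`. -/
abbrev le (R : StrandResolution.{u, v, w} k U) (i : ℕ) (a : P) : Submodule k (R.cell i →₀ k) :=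
  degreeLE k (R.active i) (R.deg i) a

/-- The part of the strand of degree `a` that comes from smaller degrees. -/
abbrev lt (R : StrandResolution.{u, v, w} k U) (i : ℕ) (a : P) : Submodule k (R.cell i →₀ k) :=
  degreeLT k (R.active i) (R.deg i) a

theorem D_mem_lt (R : StrandResolution.{u, v, w} k U) {i : ℕ} {a : P} {x : R.cell (i + 1) →₀ k}
    (hx : x ∈ R.lt (i + 1) a) : R.D i x ∈ R.lt i a :=
  map_degreeLT_of_map_degreeLE (R.D_mem i) hx

/-- No differential has a nonzero entry between cells of the same degree. -/
def IsMinimal (R : StrandResolution.{u, v, w} k U) : Prop :=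
  ∀ i, ∀ b ∈ R.active (i + 1), ∀ b' ∈ R.active i, R.deg i b' = R.deg (i + 1) b →
    R.D i (Finsupp.single b 1) b' = 0

/-- In other words, the differential of a minimal resolution vanishes modulo smaller degrees. -/
theorem IsMinimal.D_mem_lt {R : StrandResolution.{u, v, w} k U} (hR : R.IsMinimal) {i : ℕ} {a : P}
    {x : R.cell (i + 1) →₀ k} (hx : x ∈ R.le (i + 1) a) : R.D i x ∈ R.lt i a := by
  refine map_mem_of_single _ _ (fun b hb => ?_) hx
  have hm := R.D_mem i _ _ (single_mem_degreeLE hb.1 le_rfl (1 : k))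
  have : R.D i (Finsupp.single b 1) ∈ R.lt i (R.deg (i + 1) b) :=
    (mem_degreeLT_iff hm).2 fun b' hb' e => hR i b hb.1 b' hb' e
  exact degreeLT_mono _ _ hb.2 this

/-- The comparison theorem: lift one cell at a time, inside the strand of the degree of that cell,
so that the lift respects all strands. -/
theorem exists_chain_map (R : StrandResolution.{u, v, w} k U)
    (R' : StrandResolution.{u, v, w'} k U) :
    ∃ f : ∀ i, (R.cell i →₀ k) →ₗ[k] (R'.cell i →₀ k),
      (∀ i a, ∀ x ∈ R.le i a, f i x ∈ R'.le i a) ∧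
      (∀ i a, ∀ x ∈ R.le (i + 1) a, R'.D i (f (i + 1) x) = f i (R.D i x)) ∧
      ∀ x, R'.aug (f 0 x) = R.aug x := by
  obtain ⟨u, hu, hu1⟩ := R'.exists_aug_eq_one
  -- The invariant, that `f` sends boundaries to boundaries, is what makes the next component
  -- liftable.
  let A : ℕ → Type _ := fun i => {f : (R.cell i →₀ k) →ₗ[k] (R'.cell i →₀ k) //
    (∀ a, ∀ x ∈ R.le i a, f x ∈ R'.le i a) ∧
    ∀ a, ∀ x ∈ R.le (i + 1) a, ∃ y ∈ R'.le (i + 1) a, R'.D i y = f (R.D i x)}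
  have step : ∀ i (f : A i), ∃ g : A (i + 1),
      ∀ a, ∀ x ∈ R.le (i + 1) a, R'.D i (g.1 x) = f.1 (R.D i x) := by
    rintro i ⟨f, hf, hf'⟩
    obtain ⟨g, hg, hg'⟩ := exists_filtered_lift (R.active (i + 1)) (R.deg (i + 1))
      (degreeLE_mono (R'.active (i + 1)) (R'.deg (i + 1))) (R'.D i) (f ∘ₗ R.D i)
      (fun b hb => hf' _ _ (single_mem_degreeLE hb le_rfl 1))
    refine ⟨⟨g, hg, fun a x hx => ?_⟩, hg'⟩
    refine R'.exact_succ i a _ (hg a _ (R.D_mem _ a _ hx)) ?_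
    rw [hg' a _ (R.D_mem _ a _ hx)]
    simp [R.D_D i a x hx]
  have haug : ∀ x, R'.aug (LinearMap.toSpanSingleton k _ u (R.aug x)) = R.aug x := by
    intro x; simp [hu1]
  have hle : ∀ a, ∀ x : R.cell 0 →₀ k,
      LinearMap.toSpanSingleton k (R'.cell 0 →₀ k) u (R.aug x) ∈ R'.le 0 a := by
    intro a x
    exact Submodule.smul_mem _ _ (degreeLE_mono _ _ bot_le hu)
  -- `u` has degree `⊥` and augmentation `1`, so `x ↦ aug x • u` lands in every strand and preserves
  -- the augmentation.
  let f0 : A 0 := ⟨LinearMap.toSpanSingleton k _ u ∘ₗ R.aug, fun a x _ => hle a x, fun a x hx => by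
    refine R'.exact_zero a _ (hle a _) ?_
    by_cases ha : a ∈ U
    · exact Or.inl ha
    · refine Or.inr ?_
      rw [LinearMap.comp_apply, haug, R.aug_D a ha x hx]⟩
  obtain ⟨f, hf0, hf⟩ := exists_dependent_sequence (A := A)
    (fun i (f : A i) (g : A (i + 1)) =>
      ∀ a, ∀ x ∈ R.le (i + 1) a, R'.D i (g.1 x) = f.1 (R.D i x)) f0 step
  refine ⟨fun i => (f i).1, fun i => (f i).2.1, hf, fun x => ?_⟩
  show R'.aug ((f 0).1 x) = R.aug x
  rw [hf0]
  exact haug x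

/-- Applied to the difference of a composite of comparison maps and the identity, which commutes
with the differentials and has zero augmentation. -/
theorem exists_homotopy (R : StrandResolution.{u, v, w} k U)
    (R' : StrandResolution.{u, v, w'} k U) (φ : ∀ i, (R.cell i →₀ k) →ₗ[k] (R'.cell i →₀ k))
    (hφ : ∀ i a, ∀ x ∈ R.le i a, φ i x ∈ R'.le i a)
    (hD : ∀ i a, ∀ x ∈ R.le (i + 1) a, R'.D i (φ (i + 1) x) = φ i (R.D i x))
    (h0 : ∀ x, R'.aug (φ 0 x) = 0) :
    ∃ h : ∀ i, (R.cell i →₀ k) →ₗ[k] (R'.cell (i + 1) →₀ k),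
      (∀ i a, ∀ x ∈ R.le i a, h i x ∈ R'.le (i + 1) a) ∧
      (∀ a, ∀ x ∈ R.le 0 a, R'.D 0 (h 0 x) = φ 0 x) ∧
      ∀ i a, ∀ x ∈ R.le (i + 1) a, R'.D (i + 1) (h (i + 1) x) + h i (R.D i x) = φ (i + 1) x := by
  -- The invariant makes `φ (i + 1) - h ∘ D` take values in cycles, which then lift by exactness.
  let A : ℕ → Type _ := fun i => {h : (R.cell i →₀ k) →ₗ[k] (R'.cell (i + 1) →₀ k) //
    (∀ a, ∀ x ∈ R.le i a, h x ∈ R'.le (i + 1) a) ∧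
    ∀ a, ∀ x ∈ R.le (i + 1) a, R'.D i (h (R.D i x)) = φ i (R.D i x)}
  have step : ∀ i (h : A i), ∃ g : A (i + 1),
      ∀ a, ∀ x ∈ R.le (i + 1) a, R'.D (i + 1) (g.1 x) + h.1 (R.D i x) = φ (i + 1) x := by
    rintro i ⟨h, hh, hh'⟩
    obtain ⟨g, hg, hg'⟩ := exists_filtered_lift (R.active (i + 1)) (R.deg (i + 1))
      (degreeLE_mono (R'.active (i + 2)) (R'.deg (i + 2))) (R'.D (i + 1)) (φ (i + 1) - h ∘ₗ R.D i)
      (fun b hb => by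
        have hb1 := single_mem_degreeLE hb le_rfl (1 : k) (deg := R.deg (i + 1))
        refine R'.exact_succ i _ _ (Submodule.sub_mem _ (hφ _ _ _ hb1)
          (hh _ _ (R.D_mem _ _ _ hb1))) ?_
        simp [hD _ _ _ hb1, hh' _ _ hb1])
    refine ⟨⟨g, hg, fun a x hx => ?_⟩, fun a x hx => ?_⟩
    · have := hg' a _ (R.D_mem _ a _ hx)
      simpa [R.D_D i a x hx] using this
    · simp [hg' a x hx]
  obtain ⟨h0', hh0, hh0'⟩ := exists_filtered_lift (F := R'.le (0 + 1)) (R.active 0) (R.deg 0)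
    (degreeLE_mono (R'.active (0 + 1)) (R'.deg (0 + 1))) (R'.D 0) (φ 0)
    (fun b hb => R'.exact_zero (R.deg 0 b) (φ 0 (Finsupp.single b 1))
      (hφ 0 _ _ (single_mem_degreeLE hb le_rfl 1)) (Or.inr (h0 _)))
  obtain ⟨h, e, hh⟩ := exists_dependent_sequence (A := A)
    (fun i (h : A i) (g : A (i + 1)) =>
      ∀ a, ∀ x ∈ R.le (i + 1) a, R'.D (i + 1) (g.1 x) + h.1 (R.D i x) = φ (i + 1) x)
    ⟨h0', hh0, fun a x hx => hh0' a _ (R.D_mem 0 a x hx)⟩ step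
  refine ⟨fun i => (h i).1, fun i => (h i).2.1, fun a x hx => ?_, hh⟩
  show R'.D 0 ((h 0).1 x) = φ 0 x
  rw [e]
  exact hh0' a x hx

/-! ### Graded homology and the cells of a minimal resolution -/

/-- Cycles of the quotient of the strand of degree `l` by the part of smaller degree. -/
def IsGradedCycle (R : StrandResolution.{u, v, w} k U) :
    (i : ℕ) → (l : P) → (R.cell i →₀ k) → Prop
  | 0, l, z => z ∈ R.le 0 l
  | i + 1, l, z => z ∈ R.le (i + 1) l ∧ R.D i z ∈ R.lt i l

/-- Boundaries of the quotient of the strand of degree `l` by the part of smaller degree. -/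
def IsGradedBoundary (R : StrandResolution.{u, v, w} k U) (i : ℕ) (l : P) (z : R.cell i →₀ k) :
    Prop :=
  ∃ y ∈ R.le (i + 1) l, z - R.D i y ∈ R.lt i l

theorem IsGradedCycle.mem_le {R : StrandResolution.{u, v, w} k U} {i : ℕ} {l : P}
    {z : R.cell i →₀ k} (hz : R.IsGradedCycle i l z) : z ∈ R.le i l := by
  cases i with
  | zero => exact hz
  | succ i => exact hz.1

/-- Both composites of the comparison maps are homotopic to the identity. On the minimal side the
homotopy terms have smaller degree, so `g ∘ f` is the identity modulo smaller degrees; on the other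
side `f ∘ g` is the identity on graded homology. -/
theorem exists_graded_comparison {R : StrandResolution.{u, v, w} k U} (hR : R.IsMinimal)
    (T : StrandResolution.{u, v, w'} k U) :
    ∃ (f : ∀ i, (R.cell i →₀ k) →ₗ[k] (T.cell i →₀ k))
      (g : ∀ i, (T.cell i →₀ k) →ₗ[k] (R.cell i →₀ k)),
      (∀ i l, ∀ x ∈ R.lt i l, f i x ∈ T.lt i l) ∧
      (∀ i l, ∀ x ∈ T.lt i l, g i x ∈ R.lt i l) ∧
      (∀ i l, ∀ x ∈ T.le i l, g i x ∈ R.le i l) ∧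
      (∀ i l, ∀ x ∈ R.le i l, T.IsGradedCycle i l (f i x)) ∧
      (∀ i l z, T.IsGradedBoundary i l z → g i z ∈ R.lt i l) ∧
      (∀ i l, ∀ x ∈ R.le i l, g i (f i x) - x ∈ R.lt i l) ∧
      ∀ i l z, T.IsGradedCycle i l z → T.IsGradedBoundary i l (f i (g i z) - z) := by
  obtain ⟨f, hf, hfD, hf0⟩ := R.exists_chain_map T
  obtain ⟨g, hg, hgD, hg0⟩ := T.exists_chain_map R
  obtain ⟨s, hs, hs0, hsD⟩ := R.exists_homotopy R (fun i => g i ∘ₗ f i - LinearMap.id)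
    (fun i a x hx => Submodule.sub_mem _ (hg _ _ _ (hf _ _ _ hx)) hx)
    (fun i a x hx => by
      simp [hgD i a _ (hf _ _ _ hx), hfD i a x hx])
    (fun x => by simp [hg0, hf0])
  obtain ⟨t, ht, ht0, htD⟩ := T.exists_homotopy T (fun i => f i ∘ₗ g i - LinearMap.id)
    (fun i a x hx => Submodule.sub_mem _ (hf _ _ _ (hg _ _ _ hx)) hx)
    (fun i a x hx => by
      simp [hfD i a _ (hg _ _ _ hx), hgD i a x hx])
    (fun x => by simp [hg0, hf0])
  have hflt : ∀ i l, ∀ x ∈ R.lt i l, f i x ∈ T.lt i l :=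
    fun i l x hx => map_degreeLT_of_map_degreeLE (hf i) hx
  have hglt : ∀ i l, ∀ x ∈ T.lt i l, g i x ∈ R.lt i l :=
    fun i l x hx => map_degreeLT_of_map_degreeLE (hg i) hx
  refine ⟨f, g, hflt, hglt, hg, ?_, ?_, ?_, ?_⟩
  · intro i l x hx
    cases i with
    | zero => exact hf 0 l x hx
    | succ i =>
      refine ⟨hf _ l x hx, ?_⟩
      rw [hfD i l x hx]
      exact hflt _ _ _ (hR.D_mem_lt hx)
  · rintro i l z ⟨y, hy, hzy⟩
    have h1 := hglt _ _ _ hzy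
    have h2 := hR.D_mem_lt (hg _ _ _ hy)
    rw [hgD i l y hy] at h2
    simpa using Submodule.add_mem _ h1 h2
  · intro i l x hx
    cases i with
    | zero =>
      have := hs0 l x hx
      simp only [LinearMap.sub_apply, LinearMap.comp_apply, LinearMap.id_apply] at this
      rw [← this]
      exact hR.D_mem_lt (hs _ _ _ hx)
    | succ i =>
      have := hsD i l x hx
      simp only [LinearMap.sub_apply, LinearMap.comp_apply, LinearMap.id_apply] at this
      rw [← this]
      exact Submodule.add_mem _ (hR.D_mem_lt (hs _ _ _ hx))
        (map_degreeLT_of_map_degreeLE (hs i) (hR.D_mem_lt hx))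
  · intro i l z hz
    refine ⟨t i z, ht _ _ _ hz.mem_le, ?_⟩
    cases i with
    | zero =>
      have := ht0 l z hz
      simp only [LinearMap.sub_apply, LinearMap.comp_apply, LinearMap.id_apply] at this
      rw [← this, sub_self]
      exact Submodule.zero_mem _
    | succ i =>
      have := htD i l z hz.1
      simp only [LinearMap.sub_apply, LinearMap.comp_apply, LinearMap.id_apply] at this
      rw [← this, add_sub_cancel_left]
      exact map_degreeLT_of_map_degreeLE (ht i) hz.2

/-- A minimal resolution has no cell of degree `l` if the graded homology of some resolution
vanishes there. -/
theorem IsMinimal.not_exists_cell {R : StrandResolution.{u, v, w} k U} (hR : R.IsMinimal)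
    (T : StrandResolution.{u, v, w'} k U) {i : ℕ} {l : P}
    (hT : ∀ z, T.IsGradedCycle i l z → T.IsGradedBoundary i l z) :
    ¬ ∃ b ∈ R.active i, R.deg i b = l := by
  obtain ⟨f, g, -, -, -, hf, hg, hgf, -⟩ := exists_graded_comparison hR T
  rintro ⟨b, hb, hbl⟩
  have hx : Finsupp.single b (1 : k) ∈ R.le i l := single_mem_degreeLE hb hbl.le 1
  have h := Submodule.sub_mem _ (hg _ _ _ (hT _ (hf _ _ _ hx))) (hgf _ _ _ hx)
  rw [sub_sub_cancel] at h
  have := (mem_degreeLT_iff hx).1 h b hb hbl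
  simp at this

/-- A minimal resolution has exactly one cell of degree `l` if the graded homology of some
resolution is spanned by one nonzero class there. -/
theorem IsMinimal.existsUnique_cell {R : StrandResolution.{u, v, w} k U} (hR : R.IsMinimal)
    (T : StrandResolution.{u, v, w'} k U) {i : ℕ} {l : P} {z₀ : T.cell i →₀ k}
    (hz₀ : T.IsGradedCycle i l z₀) (hz₀' : ¬ T.IsGradedBoundary i l z₀)
    (hT : ∀ z, T.IsGradedCycle i l z → ∃ c : k, T.IsGradedBoundary i l (z - c • z₀)) :
    ∃! b, b ∈ R.active i ∧ R.deg i b = l := by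
  obtain ⟨f, g, hflt, hglt, hgle, hf, hg, hgf, hfg⟩ := exists_graded_comparison hR T
  -- Modulo smaller degrees, every cell of degree `l` is a multiple of `g i z₀`.
  have key : ∀ b ∈ R.active i, R.deg i b = l →
      ∃ c : k, ∀ b' ∈ R.active i, R.deg i b' = l →
        c * g i z₀ b' = Finsupp.single b (1 : k) b' := by
    intro b hb hbl
    have hx : Finsupp.single b (1 : k) ∈ R.le i l := single_mem_degreeLE hb hbl.le 1
    obtain ⟨c, hc⟩ := hT _ (hf _ _ _ hx)
    refine ⟨c, fun b' hb' hbl' => ?_⟩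
    have h := Submodule.sub_mem _ (hg _ _ _ hc) (hgf _ _ _ hx)
    have h' := (mem_degreeLT_iff (degreeLT_le_degreeLE _ _ _ h)).1 h b' hb' hbl'
    simp only [map_sub, map_smul, Finsupp.sub_apply, Finsupp.smul_apply, smul_eq_mul] at h'
    linear_combination -h'
  -- Without such a cell `g i z₀` would have smaller degree, hence so would `f i (g i z₀)`, making
  -- `z₀` a boundary.
  have hex : ∃ b, b ∈ R.active i ∧ R.deg i b = l := by
    by_contra hne
    push Not at hne
    have h1 : g i z₀ ∈ R.lt i l :=
      (mem_degreeLT_iff (hgle _ _ _ hz₀.mem_le)).2 fun b hb e => absurd e (hne b hb)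
    obtain ⟨y, hy, hyz⟩ := hfg _ _ _ hz₀
    refine hz₀' ⟨-y, Submodule.neg_mem _ hy, ?_⟩
    have := Submodule.sub_mem _ (hflt _ _ _ h1) hyz
    convert this using 1
    simp
    abel
  obtain ⟨b, hb, hbl⟩ := hex
  refine ⟨b, ⟨hb, hbl⟩, ?_⟩
  rintro b' ⟨hb', hbl'⟩
  by_contra hne
  -- Two distinct basis vectors cannot both be multiples of one vector.
  obtain ⟨c, hc⟩ := key b hb hbl
  obtain ⟨c', hc'⟩ := key b' hb' hbl'
  have h1 := hc b hb hbl
  have h2 := hc b' hb' hbl'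
  have h3 := hc' b' hb' hbl'
  rw [Finsupp.single_eq_same] at h1 h3
  rw [Finsupp.single_eq_of_ne hne] at h2
  rcases mul_eq_zero.1 h2 with h | h <;> simp [h] at h1 h3

end StrandResolution

/-! ### The Taylor resolution -/

section Taylor

open Classical in
/-- The sign `(-1)^r`, where `r` is the number of elements of `s` that precede `j`. -/
noncomputable def taylorSign (k : Type u) [Field k] {P : Type v} (j : P) (s : Finset P) : k :=
  (-1) ^ (s.filter fun x => WellOrderingRel x j).card

variable {k : Type u} [Field k] {P : Type v}

theorem taylorSign_mul_self (j : P) (s : Finset P) : taylorSign k j s * taylorSign k j s = 1 := by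
  unfold taylorSign
  rw [← mul_pow]
  simp

theorem taylorSign_ne_zero (j : P) (s : Finset P) : taylorSign k j s ≠ 0 :=
  left_ne_zero_of_mul_eq_one (taylorSign_mul_self j s)

open Classical in
theorem taylorSign_insert {i j : P} {s : Finset P} (hi : i ∉ s) :
    taylorSign k j (insert i s) = (if WellOrderingRel i j then -1 else 1) * taylorSign k j s := by
  unfold taylorSign
  rw [Finset.filter_insert]
  split_ifs with h
  · rw [Finset.card_insert_of_notMem (by simp [hi]), pow_succ']
  · rw [one_mul]

-- Exactly one of `i` and `j` precedes the other, so the two products differ by one sign. This gives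
-- both `D ∘ D = 0` and the cone identity.
open Classical in
theorem taylorSign_swap {i j : P} (hij : i ≠ j) {s : Finset P} (hi : i ∉ s) (hj : j ∉ s) :
    taylorSign k i s * taylorSign k j (insert i s) +
      taylorSign k j s * taylorSign k i (insert j s) = 0 := by
  rw [taylorSign_insert hi, taylorSign_insert hj]
  rcases trichotomous_of WellOrderingRel i j with h | h | h
  · rw [if_pos h, if_neg (asymm h)]
    ring
  · exact absurd h hij
  · rw [if_pos h, if_neg (asymm h)]
    ring

open Classical in
/-- The differential of the simplex on the vertex set `P`. -/
noncomputable def taylorD (k : Type u) [Field k] (P : Type v) :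
    (Finset P →₀ k) →ₗ[k] (Finset P →₀ k) :=
  Finsupp.linearCombination k fun s =>
    ∑ j ∈ s, Finsupp.single (s.erase j) (taylorSign k j (s.erase j))

open Classical in
/-- The cone over the vertex `v`. -/
noncomputable def taylorCone (k : Type u) [Field k] {P : Type v} (v : P) :
    (Finset P →₀ k) →ₗ[k] (Finset P →₀ k) :=
  Finsupp.linearCombination k fun s =>
    if v ∈ s then 0 else Finsupp.single (insert v s) (taylorSign k v s)

open Classical in
theorem taylorD_single (s : Finset P) (c : k) :
    taylorD k P (Finsupp.single s c) =
      ∑ j ∈ s, Finsupp.single (s.erase j) (c * taylorSign k j (s.erase j)) := by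
  simp [taylorD, Finset.smul_sum]

open Classical in
theorem taylorCone_single (v : P) (s : Finset P) (c : k) :
    taylorCone k v (Finsupp.single s c) =
      if v ∈ s then 0 else Finsupp.single (insert v s) (c * taylorSign k v s) := by
  simp [taylorCone]

open Classical in
theorem taylorD_single_erase {s : Finset P} {j : P} (hj : j ∈ s) (c : k) :
    taylorD k P (Finsupp.single s c) (s.erase j) = c * taylorSign k j (s.erase j) := by
  rw [taylorD_single, Finsupp.finsetSum_apply, Finset.sum_eq_single j]
  · simp
  · intro i hi hij
    refine Finsupp.single_eq_of_ne fun e => ?_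
    have : j ∈ s.erase i := Finset.mem_erase.2 ⟨hij.symm, hj⟩
    rw [← e] at this
    exact Finset.notMem_erase _ _ this
  · exact fun h => absurd hj h

theorem taylorD_taylorD (x : Finset P →₀ k) : taylorD k P (taylorD k P x) = 0 := by
  classical
  refine map_eq_of_single (A := Set.univ) (taylorD k P ∘ₗ taylorD k P) 0 (fun s _ => ?_) (by simp)
  simp only [LinearMap.comp_apply, LinearMap.zero_apply, taylorD_single, map_sum, one_mul]
  rw [Finset.sum_sigma' s (fun j => s.erase j) (fun j i => Finsupp.single ((s.erase j).erase i)
    (taylorSign k j (s.erase j) * taylorSign k i ((s.erase j).erase i)))]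
  -- Removing two vertices in either order gives the same face with opposite signs.
  refine Finset.sum_involution (fun p _ => ⟨p.2, p.1⟩) ?_ ?_ ?_ ?_
  · rintro ⟨j, i⟩ h
    simp only [Finset.mem_sigma, Finset.mem_erase] at h
    obtain ⟨hj, hij, hi⟩ := h
    dsimp only
    rw [Finset.erase_right_comm (a := i), ← Finsupp.single_add]
    have hi' : i ∉ (s.erase j).erase i := Finset.notMem_erase _ _
    have hj' : j ∉ (s.erase j).erase i := by simp
    have := taylorSign_swap (k := k) hij hi' hj'
    rw [Finset.insert_erase (Finset.mem_erase.2 ⟨hij, hi⟩), Finset.erase_right_comm,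
      Finset.insert_erase (Finset.mem_erase.2 ⟨hij.symm, hj⟩)] at this
    rw [Finset.erase_right_comm (a := j)]
    rw [show taylorSign k j (s.erase j) * taylorSign k i ((s.erase i).erase j) +
      taylorSign k i (s.erase i) * taylorSign k j ((s.erase i).erase j) = 0 by
        linear_combination this]
    simp
  · rintro ⟨j, i⟩ h _ e
    simp only [Finset.mem_sigma, Finset.mem_erase] at h
    simp only [Sigma.mk.injEq] at e
    exact h.2.1 e.1
  · rintro ⟨j, i⟩ h
    simp only [Finset.mem_sigma, Finset.mem_erase] at h ⊢
    exact ⟨h.2.2, h.2.1.symm, h.1⟩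
  · rintro ⟨j, i⟩ h
    rfl

/-- The cone is a contracting homotopy of the simplex with the empty face included. It yields
exactness of the Taylor resolution and the vanishing of graded homology for paired symbols. -/
theorem taylorD_taylorCone (v : P) (x : Finset P →₀ k) :
    taylorD k P (taylorCone k v x) + taylorCone k v (taylorD k P x) = x := by
  classical
  refine map_eq_of_single (A := Set.univ)
    (taylorD k P ∘ₗ taylorCone k v + taylorCone k v ∘ₗ taylorD k P) LinearMap.id
    (fun s _ => ?_) (by simp)
  simp only [LinearMap.add_apply, LinearMap.comp_apply, LinearMap.id_apply, taylorD_single,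
    taylorCone_single, map_sum, one_mul]
  by_cases hv : v ∈ s
  · rw [if_pos hv, map_zero, zero_add, Finset.sum_eq_single v]
    · rw [if_neg (Finset.notMem_erase _ _), Finset.insert_erase hv, taylorSign_mul_self]
    · intro j hj hjv
      rw [if_pos (Finset.mem_erase.2 ⟨hjv.symm, hv⟩)]
    · exact fun h => absurd hv h
  · rw [if_neg hv, taylorD_single, Finset.sum_insert hv, Finset.erase_insert hv,
      taylorSign_mul_self, add_assoc, ← Finset.sum_add_distrib, Finset.sum_eq_zero, add_zero]
    intro j hj
    have hjv : v ≠ j := fun e => hv (e ▸ hj)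
    have hv' : v ∉ s.erase j := fun h => hv (Finset.mem_of_mem_erase h)
    have hj' : j ∉ s.erase j := Finset.notMem_erase _ _
    rw [if_neg hv', Finset.erase_insert_of_ne hjv, ← Finsupp.single_add]
    have h1 := taylorSign_swap (k := k) hjv hv' hj'
    rw [Finset.insert_erase hj] at h1
    have h2 := taylorSign_mul_self (k := k) v (s.erase j)
    have h3 := taylorSign_mul_self (k := k) v s
    rw [show taylorSign k v s * taylorSign k j (insert v (s.erase j)) +
      taylorSign k j (s.erase j) * taylorSign k v (s.erase j) = 0 by
        linear_combination taylorSign k v s * taylorSign k v (s.erase j) * h1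
          - taylorSign k v s * taylorSign k j (insert v (s.erase j)) * h2
          - taylorSign k j (s.erase j) * taylorSign k v (s.erase j) * h3]
    simp

theorem taylorD_zero_of_card_zero {x : Finset P →₀ k} {A : Set (Finset P)}
    (hA : ∀ s ∈ A, s.card = 0) (hx : x ∈ Finsupp.supported k k A) : taylorD k P x = 0 := by
  classical
  refine map_eq_of_single (taylorD k P) 0 (fun s hs => ?_) hx
  rw [Finset.card_eq_zero.1 (hA s hs), taylorD_single]
  simp

variable [SemilatticeSup P] [OrderBot P]

theorem taylorCone_mem {G : Finset P} {v : P} (hv : v ∈ G) {a : P} (hva : v ≤ a) {i : ℕ}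
    {x : Finset P →₀ k}
    (hx : x ∈ degreeLE k {s : Finset P | s ⊆ G ∧ s.card = i} (fun s => s.sup id) a) :
    taylorCone k v x ∈ degreeLE k {s : Finset P | s ⊆ G ∧ s.card = i + 1}
      (fun s => s.sup id) a := by
  classical
  refine map_mem_of_single _ _ (fun s hs => ?_) hx
  rw [taylorCone_single]
  split_ifs with h
  · exact Submodule.zero_mem _
  · refine single_mem_degreeLE (C := {s : Finset P | s ⊆ G ∧ s.card = i + 1})
      ⟨Finset.insert_subset hv hs.1.1, ?_⟩ ?_ _
    · rw [Finset.card_insert_of_notMem h, hs.1.2]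
    · rw [Finset.sup_insert]
      exact sup_le hva hs.2

/-- The Taylor resolution of the quotient by the monomial ideal generated by `G`. -/
noncomputable def taylorResolution (k : Type u) [Field k] (G : Finset P) :
    StrandResolution.{u, v, v} k {a : P | ∃ g ∈ G, g ≤ a} where
  -- All homological degrees share one type of cells; `active` selects the subsets of `G` of the
  -- right cardinality.
  cell _ := Finset P
  active i := {s | s ⊆ G ∧ s.card = i}
  deg _ s := s.sup id
  D _ := taylorD k P
  aug := Finsupp.lapply ∅
  D_mem i a x hx := by
    classical
    refine map_mem_of_single _ _ (fun s hs => ?_) hx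
    rw [taylorD_single]
    refine Submodule.sum_mem _ fun j hj => ?_
    refine single_mem_degreeLE (C := {s : Finset P | s ⊆ G ∧ s.card = i})
      ⟨(Finset.erase_subset _ _).trans hs.1.1, ?_⟩ ?_ _
    · rw [Finset.card_erase_of_mem hj, hs.1.2, Nat.add_sub_cancel]
    · exact (Finset.sup_mono (Finset.erase_subset _ _)).trans hs.2
  D_D _ _ x _ := taylorD_taylorD x
  aug_D a ha x hx := by
    refine map_eq_of_single (Finsupp.lapply ∅ ∘ₗ taylorD k P) 0 (fun s hs => ?_) hx
    obtain ⟨g, rfl⟩ := Finset.card_eq_one.1 hs.1.2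
    exact absurd ⟨g, hs.1.1 (Finset.mem_singleton_self g), by simpa using hs.2⟩ ha
  exact_succ i a x hx h := by
    by_cases h0 : x = 0
    · exact ⟨0, Submodule.zero_mem _, by simp [h0]⟩
    obtain ⟨s, hs⟩ := Finsupp.ne_iff.1 h0
    obtain ⟨⟨hsG, hcard⟩, hsa⟩ := mem_degreeLE.1 hx s hs
    -- Any vertex of a set occurring in `x` divides `a`, so the cone over it stays in the strand.
    obtain ⟨g, hg⟩ := Finset.card_pos.1 (by rw [hcard]; exact i.succ_pos)
    refine ⟨taylorCone k g x,
      taylorCone_mem (hsG hg) ((Finset.le_sup (f := id) hg).trans hsa) hx, ?_⟩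
    have := taylorD_taylorCone g x
    rwa [h, map_zero, add_zero] at this
  exact_zero a x hx h := by
    rcases h with ⟨g, hg, hga⟩ | h
    · refine ⟨taylorCone k g x, taylorCone_mem hg hga hx, ?_⟩
      have := taylorD_taylorCone g x
      rwa [taylorD_zero_of_card_zero (fun s hs => hs.1.2) hx, map_zero, add_zero] at this
    · refine ⟨0, Submodule.zero_mem _, ?_⟩
      rw [map_zero]
      ext s
      by_contra hs
      have := mem_degreeLE.1 hx s (Ne.symm hs)
      rw [Finset.card_eq_zero.1 this.1.2] at hs
      exact hs h.symm
  exists_aug_eq_one := ⟨Finsupp.single ∅ 1, single_mem_degreeLE (by simp) (by simp) 1, by simp⟩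

end Taylor

/-! ### Graded homology of the Taylor resolution -/

section TaylorHomology

variable {k : Type u} [Field k] {P : Type v} [SemilatticeSup P] [OrderBot P] {G : Finset P} {l : P}

/-- The span of the Taylor symbols of homological degree `i` and degree at most `a`. -/
abbrev taylorLE (k : Type u) [Field k] (G : Finset P) (i : ℕ) (a : P) :
    Submodule k (Finset P →₀ k) :=
  degreeLE k {s : Finset P | s ⊆ G ∧ s.card = i} (fun s => s.sup id) a

/-- The span of the Taylor symbols of homological degree `i` and degree less than `a`. -/
abbrev taylorLT (k : Type u) [Field k] (G : Finset P) (i : ℕ) (a : P) :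
    Submodule k (Finset P →₀ k) :=
  degreeLT k {s : Finset P | s ⊆ G ∧ s.card = i} (fun s => s.sup id) a

theorem single_mem_taylorLE {i : ℕ} {a : P} {s : Finset P} (hs : s ⊆ G) (hi : s.card = i)
    (ha : s.sup id ≤ a) (c : k) : Finsupp.single s c ∈ taylorLE k G i a :=
  single_mem_degreeLE (C := {s : Finset P | s ⊆ G ∧ s.card = i}) ⟨hs, hi⟩ ha c

theorem taylorD_mem_LE {i : ℕ} {a : P} {x : Finset P →₀ k} (hx : x ∈ taylorLE k G (i + 1) a) :
    taylorD k P x ∈ taylorLE k G i a :=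
  (taylorResolution k G).D_mem i a x hx

theorem taylorD_mem_LT {i : ℕ} {a : P} {x : Finset P →₀ k} (hx : x ∈ taylorLT k G (i + 1) a) :
    taylorD k P x ∈ taylorLT k G i a :=
  (taylorResolution k G).D_mem_lt (i := i) hx

/-- Graded cycles of the Taylor resolution. -/
def IsTaylorCycle (G : Finset P) (i : ℕ) (l : P) (z : Finset P →₀ k) : Prop :=
  z ∈ taylorLE k G i l ∧ ∀ j, i = j + 1 → taylorD k P z ∈ taylorLT k G j l

/-- Graded boundaries of the Taylor resolution. -/
def IsTaylorBoundary (G : Finset P) (i : ℕ) (l : P) (z : Finset P →₀ k) : Prop :=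
  ∃ y ∈ taylorLE k G (i + 1) l, z - taylorD k P y ∈ taylorLT k G i l

theorem taylorResolution_isGradedCycle_iff {i : ℕ} {z : Finset P →₀ k} :
    (taylorResolution k G).IsGradedCycle i l z ↔ IsTaylorCycle G i l z := by
  cases i with
  | zero => exact ⟨fun h => ⟨h, fun j hj => by omega⟩, fun h => h.1⟩
  | succ i =>
    refine ⟨fun h => ⟨h.1, fun j hj => ?_⟩, fun h => ⟨h.1, h.2 i rfl⟩⟩
    obtain rfl : i = j := by omega
    exact h.2

theorem taylor_mem_lt_iff {i : ℕ} {x : Finset P →₀ k}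
    (hx : x ∈ taylorLE k G i l) :
    x ∈ taylorLT k G i l ↔
      ∀ s ⊆ G, s.card = i → s.sup id = l → x s = 0 :=
  (mem_degreeLT_iff hx).trans
    ⟨fun h s h1 h2 h3 => h s ⟨h1, h2⟩ h3, fun h s h1 h3 => h s h1.1 h1.2 h3⟩

theorem taylor_isGradedBoundary_of_forall_ne {i : ℕ}
    (h : ∀ s ⊆ G, s.sup id = l → s.card ≠ i) {z : Finset P →₀ k}
    (hz : IsTaylorCycle G i l z) :
    IsTaylorBoundary G i l z := by
  refine ⟨0, Submodule.zero_mem _, ?_⟩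
  rw [map_zero, sub_zero, taylor_mem_lt_iff hz.1]
  exact fun s h1 h2 h3 => absurd h2 (h s h1 h3)

/-- The differential of `z` lives one homological degree lower, where no symbol has degree `l`. -/
theorem taylor_isGradedCycle {i : ℕ} {z : Finset P →₀ k}
    (hz : z ∈ taylorLE k G i l)
    (h : ∀ s ⊆ G, s.sup id = l → s.card + 1 ≠ i) :
    IsTaylorCycle G i l z := by
  refine ⟨hz, ?_⟩
  rintro i rfl
  rw [taylor_mem_lt_iff (taylorD_mem_LE hz)]
  intro s h1 h2 h3
  exact absurd (by rw [h2]) (h s h1 h3)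

open Classical in
/-- The graded homology vanishes in degree `l` if the Taylor symbols of degree `l` come in pairs
that differ by `v`. -/
theorem taylor_isGradedBoundary_of_toggle {v : P} (hv : v ∈ G)
    (ht : ∀ s ⊆ G, ((insert v s).sup id = l ↔ (s.erase v).sup id = l)) {i : ℕ}
    {z : Finset P →₀ k} (hz : IsTaylorCycle G i l z) :
    IsTaylorBoundary G i l z := by
  have hzle := hz.1
  by_cases hlt : z ∈ taylorLT k G i l
  · exact ⟨0, Submodule.zero_mem _, by simpa using hlt⟩
  have hex : ∃ s ⊆ G, s.sup id = l := by
    rw [taylor_mem_lt_iff hzle] at hlt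
    push Not at hlt
    obtain ⟨s, h1, -, h3, -⟩ := hlt
    exact ⟨s, h1, h3⟩
  have hins : ∀ s ⊆ G, s.sup id = l → (insert v s).sup id = l := by
    intro s hs h
    by_cases hvs : v ∈ s
    · rwa [Finset.insert_eq_of_mem hvs]
    · rw [ht s hs, Finset.erase_eq_of_notMem hvs]
      exact h
  have hvl : v ≤ l := by
    obtain ⟨s, hs, h⟩ := hex
    rw [← hins s hs h]
    exact Finset.le_sup (f := id) (Finset.mem_insert_self v s)
  refine ⟨taylorCone k v z, taylorCone_mem hv hvl hzle, ?_⟩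
  have hD := taylorD_taylorCone v z
  -- Adding `v` to a set whose degree is not `l` cannot produce degree `l`, so the cone preserves
  -- the part of smaller degree.
  have hcone : taylorCone k v (taylorD k P z) ∈ taylorLT k G i l := by
    cases i with
    | zero =>
      rw [taylorD_zero_of_card_zero (fun s hs => hs.1.2) hzle, map_zero]
      exact Submodule.zero_mem _
    | succ i =>
      refine map_mem_of_single (taylorCone k v) _ (fun s hs => ?_) (hz.2 i rfl)
      have hs' : Finsupp.single s 1 ∈ taylorLE k G i l :=
        single_mem_taylorLE hs.1.1 hs.1.2 hs.2.le 1
      have := taylorCone_mem hv hvl hs'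
      rw [taylor_mem_lt_iff this]
      intro s' _ _ h3
      rw [taylorCone_single]
      split_ifs with hvs
      · simp
      · refine Finsupp.single_eq_of_ne ?_
        rintro rfl
        rw [ht s hs.1.1, Finset.erase_eq_of_notMem hvs] at h3
        exact hs.2.ne h3
  change z - taylorD k P (taylorCone k v z) ∈ _
  rwa [sub_eq_of_eq_add' hD.symm]

/-- The graded complex is a single copy of `k` with no differentials. -/
theorem taylor_single_homology {s₀ : Finset P} (hs₀ : s₀ ⊆ G) (hl : s₀.sup id = l)
    (h : ∀ s ⊆ G, s.sup id = l → s = s₀) :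
    IsTaylorCycle G s₀.card l (Finsupp.single s₀ (1 : k)) ∧
    ¬ IsTaylorBoundary G s₀.card l (Finsupp.single s₀ (1 : k)) ∧
    ∀ z, IsTaylorCycle G s₀.card l z →
      ∃ c : k, IsTaylorBoundary G s₀.card l (z - c • Finsupp.single s₀ (1 : k)) := by
  have hmem : Finsupp.single s₀ (1 : k) ∈ taylorLE k G s₀.card l :=
    single_mem_taylorLE hs₀ rfl hl.le 1
  refine ⟨taylor_isGradedCycle hmem fun s h1 h2 => ?_, ?_, fun z hz => ⟨z s₀, ?_⟩⟩
  · rw [h s h1 h2]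
    omega
  · rintro ⟨y, hy, hyz⟩
    have hy' : y ∈ taylorLT k G (s₀.card + 1) l := by
      rw [taylor_mem_lt_iff hy]
      intro s h1 h2 h3
      rw [h s h1 h3] at h2
      omega
    have := Submodule.add_mem _ hyz (taylorD_mem_LT hy')
    rw [sub_add_cancel, taylor_mem_lt_iff hmem] at this
    simpa using this s₀ hs₀ rfl hl
  · refine ⟨0, Submodule.zero_mem _, ?_⟩
    rw [map_zero, sub_zero,
      taylor_mem_lt_iff (Submodule.sub_mem _ hz.1 (Submodule.smul_mem _ _ hmem))]
    intro s h1 _ h3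
    rw [h s h1 h3]
    simp

open Classical in
/-- The differential at a facet of the only cell of degree `l` in its homological degree. -/
theorem taylorD_apply_erase {s₀ : Finset P} {i : ℕ} (hcard : s₀.card = i + 1) (hs₀ : s₀ ⊆ G)
    (hl : s₀.sup id = l) (h : ∀ s ⊆ G, s.sup id = l → s.card = i + 1 → s = s₀)
    {y : Finset P →₀ k} (hy : y ∈ taylorLE k G (i + 1) l) {j : P} (hj : j ∈ s₀)
    (hjl : (s₀.erase j).sup id = l) :
    taylorD k P y (s₀.erase j) = y s₀ * taylorSign k j (s₀.erase j) := by
  have hmem : Finsupp.single s₀ (y s₀) ∈ taylorLE k G (i + 1) l :=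
    single_mem_taylorLE hs₀ hcard hl.le _
  have h1 : y - Finsupp.single s₀ (y s₀) ∈ taylorLT k G (i + 1) l := by
    rw [taylor_mem_lt_iff (Submodule.sub_mem _ hy hmem)]
    intro s h1 h2 h3
    rw [h s h1 h3 h2]
    simp
  have h2 := taylorD_mem_LT h1
  rw [taylor_mem_lt_iff (degreeLT_le_degreeLE _ _ _ h2)] at h2
  have h3 := h2 (s₀.erase j) ((Finset.erase_subset _ _).trans hs₀)
    (by rw [Finset.card_erase_of_mem hj, hcard, Nat.add_sub_cancel]) hjl
  change taylorD k P (y - Finsupp.single s₀ (y s₀)) (s₀.erase j) = 0 at h3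
  rw [map_sub, Finsupp.sub_apply, taylorD_single_erase hj, sub_eq_zero] at h3
  exact h3

open Classical in
/-- The graded homology in degree `l` if the Taylor symbols of degree `l` are a set and two of its
facets. -/
theorem taylor_triple_homology {t : Finset P} {p q : P} (hpq : p ≠ q) (hp : p ∉ t)
    (hq : q ∉ t)
    (h : ∀ s, (s ⊆ G ∧ s.sup id = l) ↔ s = insert p t ∨ s = insert q t ∨ s = insert p (insert q t)) :
    (∀ i ≠ t.card + 1, ∀ z : Finset P →₀ k, IsTaylorCycle G i l z →
      IsTaylorBoundary G i l z) ∧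
    IsTaylorCycle G (t.card + 1) l (Finsupp.single (insert p t) (1 : k)) ∧
    ¬ IsTaylorBoundary G (t.card + 1) l (Finsupp.single (insert p t) (1 : k)) ∧
    ∀ z, IsTaylorCycle G (t.card + 1) l z →
      ∃ c : k, IsTaylorBoundary G (t.card + 1) l
        (z - c • Finsupp.single (insert p t) (1 : k)) := by
  have hpq' : p ∉ insert q t := by simp [hpq, hp]
  have hqp' : q ∉ insert p t := by simp [hpq.symm, hq]
  have cp : (insert p t).card = t.card + 1 := Finset.card_insert_of_notMem hp
  have cq : (insert q t).card = t.card + 1 := Finset.card_insert_of_notMem hq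
  have cpq : (insert p (insert q t)).card = t.card + 1 + 1 := by
    rw [Finset.card_insert_of_notMem hpq', cq]
  have mp := (h (insert p t)).2 (by simp)
  have mq := (h (insert q t)).2 (by simp)
  have mpq := (h (insert p (insert q t))).2 (by simp)
  have ep : (insert p (insert q t)).erase p = insert q t := Finset.erase_insert hpq'
  have eq : (insert p (insert q t)).erase q = insert p t := by
    rw [Finset.insert_comm, Finset.erase_insert hqp']
  have hne : insert q t ≠ insert p t := fun e => hqp' (e ▸ Finset.mem_insert_self q t)
  have uniq : ∀ s ⊆ G, s.sup id = l → s.card = t.card + 1 + 1 → s = insert p (insert q t) := by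
    intro s h1 h2 h3
    rcases (h s).1 ⟨h1, h2⟩ with rfl | rfl | rfl
    · omega
    · omega
    · rfl
  have dp : ∀ y ∈ taylorLE k G (t.card + 1 + 1) l, taylorD k P y (insert q t) =
      y (insert p (insert q t)) * taylorSign k p (insert q t) := by
    intro y hy
    have := taylorD_apply_erase cpq mpq.1 mpq.2 uniq hy (j := p) (by simp) (by rw [ep]; exact mq.2)
    rwa [ep] at this
  have dq : ∀ y ∈ taylorLE k G (t.card + 1 + 1) l, taylorD k P y (insert p t) =
      y (insert p (insert q t)) * taylorSign k q (insert p t) := by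
    intro y hy
    have := taylorD_apply_erase cpq mpq.1 mpq.2 uniq hy (j := q) (by simp) (by rw [eq]; exact mp.2)
    rwa [eq] at this
  have hmem : Finsupp.single (insert p t) (1 : k) ∈ taylorLE k G (t.card + 1) l :=
    single_mem_taylorLE mp.1 cp mp.2.le 1
  refine ⟨?_, ?_, ?_, ?_⟩
  · intro i hi z hz
    -- In the top degree the differential is injective: the coefficient at the facet `insert q t` is
    -- a sign times that of the big set.
    by_cases hi' : i = t.card + 1 + 1
    · subst hi'
      refine ⟨0, Submodule.zero_mem _, ?_⟩
      rw [map_zero, sub_zero, taylor_mem_lt_iff hz.1]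
      intro s h1 h2 h3
      rw [uniq s h1 h3 h2]
      have h4 := (taylor_mem_lt_iff (degreeLT_le_degreeLE _ _ _ (hz.2 _ rfl))).1 (hz.2 _ rfl)
        (insert q t) mq.1 cq mq.2
      have h5 := (dp z hz.1).symm.trans h4
      exact (mul_eq_zero.1 h5).resolve_right (taylorSign_ne_zero _ _)
    · refine taylor_isGradedBoundary_of_forall_ne (fun s h1 h2 => ?_) hz
      rcases (h s).1 ⟨h1, h2⟩ with rfl | rfl | rfl <;> omega
  · refine taylor_isGradedCycle hmem fun s h1 h2 => ?_
    rcases (h s).1 ⟨h1, h2⟩ with rfl | rfl | rfl <;> omega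
  · rintro ⟨y, hy, hyz⟩
    rw [taylor_mem_lt_iff (degreeLT_le_degreeLE _ _ _ hyz)] at hyz
    have h1 := hyz _ mp.1 cp mp.2
    have h2 := hyz _ mq.1 cq mq.2
    change _ - taylorD k P y (insert p t) = 0 at h1
    change _ - taylorD k P y (insert q t) = 0 at h2
    rw [dq y hy, Finsupp.single_eq_same] at h1
    rw [dp y hy, Finsupp.single_eq_of_ne hne, zero_sub, neg_eq_zero] at h2
    rw [(mul_eq_zero.1 h2).resolve_right (taylorSign_ne_zero _ _)] at h1
    simp at h1
  · intro z hz
    -- With this `a`, the boundary of the big set cancels the coefficient of `z` at `insert q t`;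
    -- what remains at `insert p t` is the scalar `c`.
    let a : k := z (insert q t) * taylorSign k p (insert q t)
    have hy : Finsupp.single (insert p (insert q t)) a ∈
        taylorLE k G (t.card + 1 + 1) l :=
      single_mem_taylorLE mpq.1 cpq mpq.2.le _
    refine ⟨z (insert p t) - a * taylorSign k q (insert p t), _, hy, ?_⟩
    have hle := Submodule.sub_mem _ (Submodule.sub_mem _ hz.1 (Submodule.smul_mem _
      (z (insert p t) - a * taylorSign k q (insert p t)) hmem))
      (taylorD_mem_LE hy)
    rw [taylor_mem_lt_iff hle]
    intro s h1 h2 h3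
    change _ - taylorD k P _ s = 0
    rcases (h s).1 ⟨h1, h3⟩ with rfl | rfl | rfl
    · rw [dq _ hy]
      simp
    · rw [dp _ hy]
      have := taylorSign_mul_self (k := k) p (insert q t)
      simp only [Finsupp.sub_apply, Finsupp.smul_apply, Finsupp.single_eq_of_ne hne,
        Finsupp.single_eq_same, a, smul_eq_mul]
      linear_combination -z (insert q t) * this
    · omega

/-! ### Sets of generators with a common least upper bound -/

open Classical in
theorem even_card_of_toggle {v : P} (hv : v ∈ G)
    (ht : ∀ s ⊆ G, ((insert v s).sup id = l ↔ (s.erase v).sup id = l)) :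
    Even (G.powerset.filter fun s => s.sup id = l).card := by
  -- Toggling `v` has no fixed points, so the count modulo 2 cancels in pairs.
  have hsum : ∑ s ∈ G.powerset.filter (fun s => s.sup id = l), (1 : ZMod 2) = 0 := by
    refine Finset.sum_involution (fun s _ => if v ∈ s then s.erase v else insert v s) ?_ ?_ ?_ ?_
    · intros
      rfl
    · intro s _ _ e
      split_ifs at e with h
      · have h' := Finset.notMem_erase v s
        rw [e] at h'
        exact h' h
      · exact h (e ▸ Finset.mem_insert_self v s)
    · intro s hs
      simp only [Finset.mem_filter, Finset.mem_powerset] at hs ⊢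
      have := ht s hs.1
      split_ifs with h
      · rw [Finset.insert_eq_of_mem h] at this
        exact ⟨(Finset.erase_subset _ _).trans hs.1, this.1 hs.2⟩
      · rw [Finset.erase_eq_of_notMem h] at this
        exact ⟨Finset.insert_subset hv hs.1, this.2 hs.2⟩
    · intro s _
      by_cases h : v ∈ s
      · simp only [if_pos h, if_neg (Finset.notMem_erase v s), Finset.insert_erase h]
      · simp only [if_neg h, if_pos (Finset.mem_insert_self v s), Finset.erase_insert h]
  rw [Finset.sum_const, nsmul_eq_mul, mul_one, ZMod.natCast_eq_zero_iff] at hsum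
  exact even_iff_two_dvd.2 hsum

open Classical in
/-- The sets with a given least upper bound are closed under toggling `v` if they are among the
four sets between `t` and `t ∪ {v, w}`. -/
theorem toggle_of_mem_four {t : Finset P} {v w : P} (hv : v ∈ G) (hvw : v ≠ w) (hvt : v ∉ t)
    (hmem : ∀ s ⊆ G, s.sup id = l →
      s = t ∨ s = insert v t ∨ s = insert w t ∨ s = insert v (insert w t))
    (h1 : t.sup id = l ↔ (insert v t).sup id = l)
    (h2 : (insert w t).sup id = l ↔ (insert v (insert w t)).sup id = l) (s : Finset P)
    (hs : s ⊆ G) : (insert v s).sup id = l ↔ (s.erase v).sup id = l := by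
  have hvwt : v ∉ insert w t := by simp [hvw, hvt]
  constructor
  · intro h
    have e : s.erase v = (insert v s).erase v := by
      rw [Finset.erase_insert_eq_erase]
    rw [e]
    rcases hmem _ (Finset.insert_subset hv hs) h with e | e | e | e
    · exact absurd (e ▸ Finset.mem_insert_self v s) hvt
    · rw [e, Finset.erase_insert hvt, h1, ← e, h]
    · exact absurd (e ▸ Finset.mem_insert_self v s) hvwt
    · rw [e, Finset.erase_insert hvwt, h2, ← e, h]
  · intro h
    have e : insert v s = insert v (s.erase v) := by
      ext x
      by_cases hx : x = v <;> simp [hx]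
    rw [e]
    rcases hmem _ ((Finset.erase_subset _ _).trans hs) h with e | e | e | e
    · rw [e, ← h1, ← e, h]
    · exact absurd (e ▸ Finset.mem_insert_self v t) (Finset.notMem_erase v s)
    · rw [e, ← h2, ← e, h]
    · exact absurd (e ▸ Finset.mem_insert_self v _) (Finset.notMem_erase v s)

/-- Here `a`, `b`, `c`, `d` say that `t`, `t ∪ {p}`, `t ∪ {q}`, `t ∪ {p, q}` have least upper bound
`l`. The join of the middle two gives `h1`; monotonicity gives `h2` and `h3`. -/
theorem four_cases {a b c d : Prop} (h1 : b → c → d) (h2 : a → d → b) (h3 : a → d → c)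
    (h : a ∨ b ∨ c ∨ d) :
    ((a ↔ b) ∧ (c ↔ d)) ∨ ((a ↔ c) ∧ (b ↔ d)) ∨ (a ∧ ¬b ∧ ¬c ∧ ¬d) ∨ (¬a ∧ b ∧ ¬c ∧ ¬d) ∨
      (¬a ∧ ¬b ∧ c ∧ ¬d) ∨ (¬a ∧ ¬b ∧ ¬c ∧ d) ∨ (¬a ∧ b ∧ c ∧ d) := by
  by_cases a <;> by_cases b <;> by_cases c <;> by_cases d <;> simp_all

open Classical in
/-- If the sets of generators with a given least upper bound differ only in `p` and `q`, they come
in pairs, or there is only one, or they are a set together with two of its facets. -/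
theorem toggle_or_unique_or_triple {p q : P} (hp : p ∈ G) (hq : q ∈ G) (hpq : p ≠ q)
    (hG : ∀ s ⊆ G, ∀ s' ⊆ G, s.sup id = l → s'.sup id = l →
      (s.erase p).erase q = (s'.erase p).erase q) :
    (∃ v ∈ G, ∀ s ⊆ G, ((insert v s).sup id = l ↔ (s.erase v).sup id = l)) ∨
    (∃ s₀ ⊆ G, s₀.sup id = l ∧ ∀ s ⊆ G, s.sup id = l → s = s₀) ∨
    ∃ t, p ∉ t ∧ q ∉ t ∧ ∀ s, (s ⊆ G ∧ s.sup id = l) ↔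
      s = insert p t ∨ s = insert q t ∨ s = insert p (insert q t) := by
  by_cases hex : ∃ s ⊆ G, s.sup id = l
  swap
  -- With no set of least upper bound `l`, the toggling condition is vacuous.
  · refine Or.inl ⟨p, hp, fun s hs => ⟨fun h => ?_, fun h => ?_⟩⟩
    · exact absurd ⟨_, Finset.insert_subset hp hs, h⟩ hex
    · exact absurd ⟨_, (Finset.erase_subset _ _).trans hs, h⟩ hex
  obtain ⟨s₁, hs₁, hl₁⟩ := hex
  obtain ⟨t, ht⟩ : ∃ t, t = (s₁.erase p).erase q := ⟨_, rfl⟩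
  have hpt : p ∉ t := by simp [ht]
  have hqt : q ∉ t := by simp [ht]
  have htG : t ⊆ G := ht ▸ (Finset.erase_subset _ _).trans ((Finset.erase_subset _ _).trans hs₁)
  have mem_four : ∀ s : Finset P, (s.erase p).erase q = t →
      s = t ∨ s = insert p t ∨ s = insert q t ∨ s = insert p (insert q t) := by
    rintro s rfl
    by_cases h1 : p ∈ s <;> by_cases h2 : q ∈ s
    · refine Or.inr (Or.inr (Or.inr ?_))
      rw [Finset.insert_erase (Finset.mem_erase.2 ⟨hpq.symm, h2⟩), Finset.insert_erase h1]
    · refine Or.inr (Or.inl ?_)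
      rw [Finset.erase_eq_of_notMem (s := s.erase p) (by simp [h2]), Finset.insert_erase h1]
    · refine Or.inr (Or.inr (Or.inl ?_))
      rw [Finset.erase_eq_of_notMem h1, Finset.insert_erase h2]
    · refine Or.inl ?_
      rw [Finset.erase_eq_of_notMem h1, Finset.erase_eq_of_notMem h2]
  have mem : ∀ s ⊆ G, s.sup id = l →
      s = t ∨ s = insert p t ∨ s = insert q t ∨ s = insert p (insert q t) :=
    fun s h1 h2 => mem_four s ((hG s h1 s₁ hs₁ h2 hl₁).trans ht.symm)
  have tp : insert p t ⊆ G := Finset.insert_subset hp htG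
  have tq : insert q t ⊆ G := Finset.insert_subset hq htG
  have tpq : insert p (insert q t) ⊆ G := Finset.insert_subset hp tq
  have epq : (insert p (insert q t)).sup id = (insert p t).sup id ⊔ (insert q t).sup id := by
    simp only [Finset.sup_insert, id]
    rw [sup_assoc, sup_left_comm (t.sup id), sup_idem]
  have c1 : (insert p t).sup id = l → (insert q t).sup id = l →
      (insert p (insert q t)).sup id = l := by
    intro h1 h2
    rw [epq, h1, h2, sup_idem]
  have mono : ∀ {a b : Finset P}, a ⊆ b → a.sup id ≤ b.sup id := fun h => Finset.sup_mono h
  have c2 : t.sup id = l → (insert p (insert q t)).sup id = l → (insert p t).sup id = l := by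
    intro h1 h2
    refine le_antisymm ?_ ?_
    · rw [← h2, epq]
      exact le_sup_left
    · rw [← h1]
      exact mono (Finset.subset_insert _ _)
  have c3 : t.sup id = l → (insert p (insert q t)).sup id = l → (insert q t).sup id = l := by
    intro h1 h2
    refine le_antisymm ?_ ?_
    · rw [← h2, epq]
      exact le_sup_right
    · rw [← h1]
      exact mono (Finset.subset_insert _ _)
  have some_mem : t.sup id = l ∨ (insert p t).sup id = l ∨ (insert q t).sup id = l ∨
      (insert p (insert q t)).sup id = l := by
    rcases mem s₁ hs₁ hl₁ with e | e | e | e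
    · exact Or.inl (e ▸ hl₁)
    · exact Or.inr (Or.inl (e ▸ hl₁))
    · exact Or.inr (Or.inr (Or.inl (e ▸ hl₁)))
    · exact Or.inr (Or.inr (Or.inr (e ▸ hl₁)))
  have mem' : ∀ s ⊆ G, s.sup id = l →
      s = t ∨ s = insert q t ∨ s = insert p t ∨ s = insert q (insert p t) := by
    intro s h1 h2
    rcases mem s h1 h2 with e | e | e | e
    · exact Or.inl e
    · exact Or.inr (Or.inr (Or.inl e))
    · exact Or.inr (Or.inl e)
    · exact Or.inr (Or.inr (Or.inr (e.trans (Finset.insert_comm _ _ _))))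
  have toggle_p := toggle_of_mem_four hp hpq hpt mem
  have toggle_q := toggle_of_mem_four hq hpq.symm hqt mem'
  rw [Finset.insert_comm q p t] at toggle_q
  rcases four_cases c1 c2 c3 some_mem with ⟨h1, h2⟩ | ⟨h1, h2⟩ | ⟨m0, mp, mq, mpq⟩ |
    ⟨m0, mp, mq, mpq⟩ | ⟨m0, mp, mq, mpq⟩ | ⟨m0, mp, mq, mpq⟩ | ⟨m0, mp, mq, mpq⟩
  · exact Or.inl ⟨p, hp, toggle_p h1 h2⟩
  · exact Or.inl ⟨q, hq, toggle_q h1 h2⟩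
  · refine Or.inr (Or.inl ⟨t, htG, m0, fun s h1 h2 => ?_⟩)
    rcases mem s h1 h2 with e | e | e | e <;> rw [e] at h2 <;> first | exact e | contradiction
  · refine Or.inr (Or.inl ⟨_, tp, mp, fun s h1 h2 => ?_⟩)
    rcases mem s h1 h2 with e | e | e | e <;> rw [e] at h2 <;> first | exact e | contradiction
  · refine Or.inr (Or.inl ⟨_, tq, mq, fun s h1 h2 => ?_⟩)
    rcases mem s h1 h2 with e | e | e | e <;> rw [e] at h2 <;> first | exact e | contradiction
  · refine Or.inr (Or.inl ⟨_, tpq, mpq, fun s h1 h2 => ?_⟩)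
    rcases mem s h1 h2 with e | e | e | e <;> rw [e] at h2 <;> first | exact e | contradiction
  · refine Or.inr (Or.inr ⟨t, hpt, hqt, fun s => ⟨fun h => ?_, ?_⟩⟩)
    · refine (mem s h.1 h.2).resolve_left fun e => m0 ?_
      rw [← e, h.2]
    · rintro (rfl | rfl | rfl)
      exacts [⟨tp, mp⟩, ⟨tq, mq⟩, ⟨tpq, mpq⟩]

open Classical in
/-- The cells of a minimal resolution, if the sets of generators with a given least upper bound
differ only in two generators. -/
theorem StrandResolution.IsMinimal.cells_of_differ_in_two
    {R : StrandResolution.{u, v, w} k {a : P | ∃ g ∈ G, g ≤ a}} (hR : R.IsMinimal) {p q : P}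
    (hp : p ∈ G) (hq : q ∈ G) (hpq : p ≠ q)
    (hG : ∀ s ⊆ G, ∀ s' ⊆ G, s.sup id = l → s'.sup id = l →
      (s.erase p).erase q = (s'.erase p).erase q) (i : ℕ) :
    if Odd (G.powerset.filter fun s => s.sup id = l).card ∧
        i = sInf {j | ∃ s ∈ G.powerset.filter (fun s => s.sup id = l), s.card = j}
      then ∃! b, b ∈ R.active i ∧ R.deg i b = l
      else ¬ ∃ b ∈ R.active i, R.deg i b = l := by
  rcases toggle_or_unique_or_triple hp hq hpq hG with ⟨v, hv, h⟩ | ⟨s₀, hs₀, hl, h⟩ |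
    ⟨t, hpt, hqt, h⟩
  -- Paired symbols: their number is even, so `l` is not in `L`, and the homology is zero.
  · rw [if_neg fun h' => Nat.not_even_iff_odd.2 h'.1 (even_card_of_toggle hv h)]
    exact hR.not_exists_cell (taylorResolution k G) fun z hz =>
      taylor_isGradedBoundary_of_toggle hv h (taylorResolution_isGradedCycle_iff.1 hz)
  · have hfil : G.powerset.filter (fun s => s.sup id = l) = {s₀} := by
      ext s
      simp only [Finset.mem_filter, Finset.mem_powerset, Finset.mem_singleton]
      exact ⟨fun hs => h s hs.1 hs.2, by rintro rfl; exact ⟨hs₀, hl⟩⟩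
    have hinf : sInf {j | ∃ s ∈ ({s₀} : Finset (Finset P)), s.card = j} = s₀.card := by
      simp
    rw [hfil, hinf]
    split_ifs with hi
    · obtain ⟨-, rfl⟩ := hi
      obtain ⟨h1, h2, h3⟩ := taylor_single_homology (k := k) hs₀ hl h
      exact hR.existsUnique_cell (taylorResolution k G)
        (taylorResolution_isGradedCycle_iff.2 h1) h2 fun z hz =>
          h3 z (taylorResolution_isGradedCycle_iff.1 hz)
    · refine hR.not_exists_cell (taylorResolution k G) fun z hz =>
        taylor_isGradedBoundary_of_forall_ne (fun s h1 h2 e => ?_)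
          (taylorResolution_isGradedCycle_iff.1 hz)
      rw [h s h1 h2] at e
      exact hi ⟨by simp, e.symm⟩
  -- Three symbols: an odd number, with least cardinality `t.card + 1`, where the only class lives.
  · obtain ⟨h0, h1, h2, h3⟩ := taylor_triple_homology (k := k) hpq hpt hqt h
    have hpq' : p ∉ insert q t := by simp [hpq, hpt]
    have cp : (insert p t).card = t.card + 1 := Finset.card_insert_of_notMem hpt
    have cq : (insert q t).card = t.card + 1 := Finset.card_insert_of_notMem hqt
    have cpq : (insert p (insert q t)).card = t.card + 1 + 1 := by
      rw [Finset.card_insert_of_notMem hpq', cq]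
    have hfil : G.powerset.filter (fun s => s.sup id = l) =
        {insert p t, insert q t, insert p (insert q t)} := by
      ext s
      simp only [Finset.mem_filter, Finset.mem_powerset, Finset.mem_singleton, Finset.mem_insert]
      exact h s
    have hne1 : insert p t ≠ insert q t := by
      intro e
      have : p ∈ insert q t := e ▸ Finset.mem_insert_self p t
      exact hpq' this
    have hcard : ({insert p t, insert q t, insert p (insert q t)} : Finset (Finset P)).card = 3 := by
      rw [Finset.card_eq_three]
      refine ⟨_, _, _, hne1, fun e => ?_, fun e => ?_, rfl⟩ <;>
      · have := congrArg Finset.card e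
        omega
    have hinf : sInf {j | ∃ s ∈ ({insert p t, insert q t, insert p (insert q t)} :
        Finset (Finset P)), s.card = j} = t.card + 1 := by
      refine IsLeast.csInf_eq ⟨⟨insert p t, by simp, cp⟩, ?_⟩
      rintro j ⟨s, hs, rfl⟩
      simp only [Finset.mem_singleton, Finset.mem_insert] at hs
      rcases hs with rfl | rfl | rfl <;> omega
    rw [hfil, hinf, hcard]
    split_ifs with hi
    · obtain ⟨-, rfl⟩ := hi
      exact hR.existsUnique_cell (taylorResolution k G)
        (taylorResolution_isGradedCycle_iff.2 h1) h2 fun z hz =>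
          h3 z (taylorResolution_isGradedCycle_iff.1 hz)
    · exact hR.not_exists_cell (taylorResolution k G) fun z hz =>
        h0 i (fun e => hi ⟨by decide, e⟩) z (taylorResolution_isGradedCycle_iff.1 hz)

end TaylorHomology

/-! ### Existence of minimal resolutions -/

section MinimalCover

variable {k : Type u} [Field k] {P : Type v} [Lattice P] {J : Type w}

/-- A bounded graded submodule of a finite free module has a minimal cover by a finite free
module. -/
theorem exists_minimal_cover [Finite J] {L : P} (hL : (Set.Iic L).Finite)
    (Z : P → Submodule k (J →₀ k)) (hmono : Monotone Z) (hZL : ∀ a, Z a ≤ Z (a ⊓ L)) :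
    ∃ (n : ℕ) (deg : Fin n → P) (D : (Fin n →₀ k) →ₗ[k] (J →₀ k)), (∀ b, deg b ≤ L) ∧
      (∀ a, ∀ x ∈ degreeLE k Set.univ deg a, D x ∈ Z a) ∧
      (∀ a, ∀ x ∈ Z a, ∃ y ∈ degreeLE k Set.univ deg a, D y = x) ∧
      ∀ a, ∀ x ∈ degreeLE k Set.univ deg a, D x = 0 → ∀ b, deg b = a → x b = 0 := by
  classical
  -- Finite sets of homogeneous generators of `Z` in degrees at most `L`. One that is minimal under
  -- inclusion gives the minimal cover.
  let good : Finset (P × (J →₀ k)) → Prop := fun X =>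
    (∀ w ∈ X, w.2 ∈ Z w.1 ∧ w.1 ≤ L) ∧
      ∀ a, Z a ≤ Submodule.span k (Prod.snd '' {w | w ∈ X ∧ w.1 ≤ a})
  obtain ⟨X₀, hX₀⟩ : ∃ X, good X := by
    have hfg : ∀ a, ∃ B : Finset (J →₀ k), Submodule.span k (B : Set (J →₀ k)) = Z a :=
      fun a => IsNoetherian.noetherian (Z a)
    choose B hB using hfg
    refine ⟨hL.toFinset.biUnion fun a => (B a).image fun x => (a, x), ?_, fun a => ?_⟩
    · intro w hw
      simp only [Finset.mem_biUnion, Finset.mem_image, Set.Finite.mem_toFinset, Set.mem_Iic] at hw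
      obtain ⟨a, ha, x, hx, rfl⟩ := hw
      exact ⟨hB a ▸ Submodule.subset_span hx, ha⟩
    · refine (hZL a).trans ?_
      rw [← hB (a ⊓ L)]
      refine Submodule.span_mono fun x hx => ⟨(a ⊓ L, x), ⟨?_, inf_le_left⟩, rfl⟩
      simp only [Finset.mem_biUnion, Finset.mem_image, Set.Finite.mem_toFinset, Set.mem_Iic]
      exact ⟨a ⊓ L, inf_le_right, x, hx, rfl⟩
  obtain ⟨X, -, hX⟩ := exists_minimal_le_of_wellFoundedLT good X₀ hX₀
  let e : Fin X.card ≃ X := X.equivFin.symm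
  let D : (Fin X.card →₀ k) →ₗ[k] (J →₀ k) := Finsupp.linearCombination k fun b => (e b).1.2
  have hD : ∀ b, D (Finsupp.single b 1) = (e b).1.2 := fun b => by simp [D]
  refine ⟨X.card, fun b => (e b).1.1, D, fun b => (hX.1.1 _ (e b).2).2, ?_, ?_, ?_⟩
  · intro a x hx
    refine map_mem_of_single D _ (fun b hb => ?_) hx
    rw [hD]
    exact hmono hb.2 (hX.1.1 _ (e b).2).1
  · intro a x hx
    have hle : Submodule.span k (Prod.snd '' {w | w ∈ X ∧ w.1 ≤ a}) ≤
        (degreeLE k Set.univ (fun b => (e b).1.1) a).map D := by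
      rw [Submodule.span_le]
      rintro _ ⟨w, ⟨hw, hwa⟩, rfl⟩
      refine ⟨Finsupp.single (e.symm ⟨w, hw⟩) 1, single_mem_degreeLE (Set.mem_univ _) ?_ 1, ?_⟩
      · simpa using hwa
      · rw [hD]
        simp
    exact hle (hX.1.2 a hx)
  · intro a x hx hDx b hb
    by_contra hne
    -- A relation of degree `a` with nonzero coefficient at a generator of degree `a` expresses that
    -- generator through the others, contradicting minimality of `X`.
    have hgood : good (X.erase (e b).1) := by
      refine ⟨fun w hw => hX.1.1 w (Finset.mem_of_mem_erase hw), fun c => (hX.1.2 c).trans ?_⟩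
      rw [Submodule.span_le]
      rintro _ ⟨w, ⟨hw, hwc⟩, rfl⟩
      by_cases hwb : w = (e b).1
      swap
      · exact Submodule.subset_span ⟨w, ⟨Finset.mem_erase.2 ⟨hwb, hw⟩, hwc⟩, rfl⟩
      have hsub : D (x - Finsupp.single b (x b)) ∈ Submodule.span k
          (Prod.snd '' {w | w ∈ X.erase (e b).1 ∧ w.1 ≤ c}) := by
        refine map_mem_of_single (A := {b' | b' ≠ b ∧ (e b').1.1 ≤ a}) D _ (fun b' hb' => ?_) ?_
        · rw [hD]
          refine Submodule.subset_span ⟨_, ⟨Finset.mem_erase.2 ⟨?_, (e b').2⟩, ?_⟩, rfl⟩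
          · exact fun h => hb'.1 (e.injective (Subtype.ext h))
          · refine hb'.2.trans ?_
            have hba : (e b).1.1 = a := hb
            rw [← hba, ← hwb]
            exact hwc
        · rw [Finsupp.mem_supported]
          intro b' hb'
          have h1 := Finsupp.mem_support_iff.1 hb'
          have hbb : b' ≠ b := by
            rintro rfl
            simp at h1
          rw [Finsupp.sub_apply, Finsupp.single_eq_of_ne hbb, sub_zero] at h1
          exact ⟨hbb, (mem_degreeLE.1 hx b' h1).2⟩
      have hval : D (x - Finsupp.single b (x b)) = -(x b • w.2) := by
        rw [map_sub, hDx, zero_sub, hwb, ← hD b, ← map_smul, Finsupp.smul_single, smul_eq_mul,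
          mul_one]
      rw [hval, Submodule.neg_mem_iff] at hsub
      exact (Submodule.smul_mem_iff _ hne).1 hsub
    have := hX.2 hgood (Finset.erase_subset _ _) (e b).2
    exact Finset.notMem_erase _ _ this

/-- A finite free graded module together with a graded submodule that is generated in degrees
at most `L` and is contained in the part of smaller degree. -/
structure SyzygyStage (k : Type u) [Field k] {P : Type v} [Lattice P] (L : P) where
  n : ℕ
  deg : Fin n → P
  Z : P → Submodule k (Fin n →₀ k)
  Z_le : ∀ a, Z a ≤ degreeLE k Set.univ deg a
  mono : Monotone Z
  Z_le_inf : ∀ a, Z a ≤ Z (a ⊓ L)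
  minimal : ∀ a, ∀ x ∈ Z a, ∀ b, deg b = a → x b = 0

/-- The stage `t` is a minimal cover of the syzygies of the stage `s`. -/
structure SyzygyStage.Covers {L : P} (s t : SyzygyStage k L)
    (D : (Fin t.n →₀ k) →ₗ[k] (Fin s.n →₀ k)) : Prop where
  map_mem : ∀ a, ∀ x ∈ degreeLE k Set.univ t.deg a, D x ∈ s.Z a
  surj : ∀ a, ∀ x ∈ s.Z a, ∃ y ∈ degreeLE k Set.univ t.deg a, D y = x
  ker : ∀ a, ∀ x ∈ degreeLE k Set.univ t.deg a, (x ∈ t.Z a ↔ D x = 0)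

/-- The kernel of a minimal cover is again a stage: the cells of the cover have degree at most `L`,
so the kernel in degree `a` already occurs in degree `a ⊓ L`. -/
theorem SyzygyStage.exists_covers {L : P} (hL : (Set.Iic L).Finite) (s : SyzygyStage k L) :
    ∃ (t : SyzygyStage k L) (D : _), s.Covers t D := by
  obtain ⟨n, deg, D, hdeg, h1, h2, h3⟩ := exists_minimal_cover hL s.Z s.mono s.Z_le_inf
  refine ⟨⟨n, deg, fun a => degreeLE k Set.univ deg a ⊓ LinearMap.ker D, fun a => inf_le_left,
    fun a b h => inf_le_inf_right _ (degreeLE_mono _ _ h), fun a x hx => ⟨?_, hx.2⟩,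
    fun a x hx => h3 a x hx.1 hx.2⟩, D, h1, h2, fun a x hx => ⟨fun h => h.2, fun h => ⟨hx, h⟩⟩⟩
  rw [SetLike.mem_coe, mem_degreeLE]
  exact fun b hb => ⟨trivial, le_inf (mem_degreeLE.1 hx.1 b hb).2 (hdeg b)⟩

theorem StrandResolution.exists_minimal [OrderBot P] {U : Set P} {L : P} (hL : (Set.Iic L).Finite)
    (hU : IsUpperSet U) (hUL : ∀ a ∈ U, a ⊓ L ∈ U) (hbot : ⊥ ∉ U) :
    ∃ R : StrandResolution.{u, v, 0} k U,
      R.IsMinimal ∧ (∀ i, Finite (R.cell i)) ∧ ∀ i, R.active i = Set.univ := by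
  classical
  -- The stage of `S/M`: one cell of degree `⊥`, with the ideal as its syzygies. It is minimal
  -- because `⊥ ∉ U`.
  let s₀ : SyzygyStage k L :=
    { n := 1
      deg := fun _ => ⊥
      Z := fun a => if a ∈ U then ⊤ else ⊥
      Z_le := fun a x _ => mem_degreeLE.2 fun b _ => ⟨trivial, bot_le⟩
      mono := fun a b hab => by
        dsimp only
        by_cases ha : a ∈ U
        · simp [ha, hU hab ha]
        · simp [ha]
      Z_le_inf := fun a => by
        by_cases ha : a ∈ U
        · simp [ha, hUL a ha]
        · simp [ha]
      minimal := by
        rintro a x hx b rfl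
        rw [if_neg hbot] at hx
        rw [(Submodule.mem_bot k).1 hx]
        rfl }
  -- Packaged as one statement about `s₀` so that it can be transported along `hf0` to `f 0`.
  have haug₀ : ∃ aug : (Fin s₀.n →₀ k) →ₗ[k] k,
      (∀ a, ∀ x, (x ∈ s₀.Z a ↔ a ∈ U ∨ aug x = 0)) ∧
      ∃ x ∈ degreeLE k Set.univ s₀.deg ⊥, aug x = 1 := by
    refine ⟨Finsupp.lapply (0 : Fin 1), fun a x => ?_, Finsupp.single (0 : Fin 1) 1,
      single_mem_degreeLE (Set.mem_univ _) le_rfl 1, by simp⟩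
    change x ∈ (if a ∈ U then ⊤ else ⊥ : Submodule k (Fin 1 →₀ k)) ↔ a ∈ U ∨ x (0 : Fin 1) = 0
    by_cases ha : a ∈ U
    · simp [ha]
    · simp only [ha, if_false, Submodule.mem_bot, false_or]
      constructor
      · rintro rfl
        rfl
      · intro h
        refine Finsupp.ext fun b : Fin 1 => ?_
        rw [Subsingleton.elim b 0, h]
        rfl
  obtain ⟨f, hf0, hf⟩ := exists_dependent_sequence (A := fun _ => SyzygyStage k L)
    (fun _ s t => ∃ D : _, s.Covers t D) s₀ fun _ s => s.exists_covers hL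
  rw [← hf0] at haug₀
  obtain ⟨aug, haug, haug1⟩ := haug₀
  choose D hD using hf
  refine ⟨{ cell := fun i => Fin (f i).n
            active := fun _ => Set.univ
            deg := fun i => (f i).deg
            D := D
            aug := aug
            D_mem := fun i a x hx => (f i).Z_le a ((hD i).map_mem a x hx)
            D_D := fun i a x hx => ?_
            aug_D := fun a ha x hx => ?_
            exact_succ := fun i a x hx h => ?_
            exact_zero := fun a x hx h => ?_
            exists_aug_eq_one := haug1 }, ?_, fun i => Finite.of_fintype (Fin (f i).n),
          fun i => rfl⟩
  · have h := (hD (i + 1)).map_mem a x hx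
    exact ((hD i).ker a _ ((f (i + 1)).Z_le a h)).1 h
  · exact ((haug a _).1 ((hD 0).map_mem a x hx)).resolve_left ha
  · exact (hD (i + 1)).surj a x (((hD i).ker a x hx).2 h)
  · exact (hD 0).surj a x ((haug a x).2 h)
  · intro i b _ b' _ hbb'
    exact (f i).minimal _ _ ((hD i).map_mem _ _ (single_mem_degreeLE (Set.mem_univ _) le_rfl 1)) b' hbb'

end MinimalCover

/-! ### Passage between polynomial modules and strands over the field -/

section Dehomogenization

open MvPolynomial

variable {σ : Type v} {k : Type u} [Field k] {J : Type w} {J' : Type w'}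

/-- The part of degree `a` of an element of a graded free module. -/
noncomputable def strand (deg : J → σ →₀ ℕ) (a : σ →₀ ℕ) :
    (J →₀ MvPolynomial σ k) →ₗ[k] (J →₀ k) where
  -- Multiplying by the monomial of degree `deg b` avoids subtracting exponents, and the coefficient
  -- is zero unless `deg b ≤ a`.
  toFun p := Finsupp.onFinset p.support (fun b => coeff a (p b * monomial (deg b) 1)) fun b hb => by
    rw [Finsupp.mem_support_iff]
    intro h
    simp [h] at hb
  map_add' p q := by
    ext b
    simp [add_mul]
  map_smul' c p := by
    ext b
    simp

@[simp]
theorem strand_apply (deg : J → σ →₀ ℕ) (a : σ →₀ ℕ) (p : J →₀ MvPolynomial σ k) (b : J) :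
    strand deg a p b = coeff a (p b * monomial (deg b) 1) := rfl

/-- The homogeneous element of degree `a` with given coefficients. -/
noncomputable def homogenize (deg : J → σ →₀ ℕ) (a : σ →₀ ℕ) (x : J →₀ k) :
    J →₀ MvPolynomial σ k :=
  -- The subtraction is truncated, so this has degree `a` only when `x` is supported on cells of
  -- degree at most `a`.
  Finsupp.onFinset x.support (fun b => monomial (a - deg b) (x b)) fun b hb => by
    rw [Finsupp.mem_support_iff]
    intro h
    simp [h] at hb

theorem homogenize_apply (deg : J → σ →₀ ℕ) (a : σ →₀ ℕ) (x : J →₀ k) (b : J) :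
    homogenize deg a x b = monomial (a - deg b) (x b) := rfl

theorem homogenize_apply_mul {deg : J → σ →₀ ℕ} {a : σ →₀ ℕ} {x : J →₀ k}
    (hx : x ∈ degreeLE k Set.univ deg a) (b : J) :
    homogenize deg a x b * monomial (deg b) 1 = monomial a (x b) := by
  rw [homogenize_apply, monomial_mul, mul_one]
  by_cases h : x b = 0
  · simp [h]
  · rw [tsub_add_cancel_of_le (mem_degreeLE.1 hx b h).2]

open Classical in
theorem strand_homogenize {deg : J → σ →₀ ℕ} {a : σ →₀ ℕ} {x : J →₀ k}
    (hx : x ∈ degreeLE k Set.univ deg a) (a' : σ →₀ ℕ) :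
    strand deg a' (homogenize deg a x) = if a = a' then x else 0 := by
  ext b
  rw [strand_apply, homogenize_apply_mul hx, coeff_monomial]
  split_ifs <;> rfl

theorem strand_homogenize_self {deg : J → σ →₀ ℕ} {a : σ →₀ ℕ} {x : J →₀ k}
    (hx : x ∈ degreeLE k Set.univ deg a) : strand deg a (homogenize deg a x) = x := by
  classical
  rw [strand_homogenize hx, if_pos rfl]

theorem strand_mem (deg : J → σ →₀ ℕ) (a : σ →₀ ℕ) (p : J →₀ MvPolynomial σ k) :
    strand deg a p ∈ degreeLE k Set.univ deg a := by
  classical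
  rw [mem_degreeLE]
  intro b hb
  refine ⟨trivial, ?_⟩
  by_contra h
  rw [strand_apply, coeff_mul_monomial', if_neg h] at hb
  exact hb rfl

/-- The strands determine each `p b` times a monomial, and multiplication by a monomial is
injective. -/
theorem eq_zero_of_strand {deg : J → σ →₀ ℕ} {p : J →₀ MvPolynomial σ k}
    (h : ∀ a, strand deg a p = 0) : p = 0 := by
  ext1 b
  have h1 : p b * monomial (deg b) 1 = 0 := by
    ext a
    exact DFunLike.congr_fun (h a) b
  refine (mul_eq_zero.1 h1).resolve_right ?_
  simp

theorem eq_of_strand {deg : J → σ →₀ ℕ} {p q : J →₀ MvPolynomial σ k}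
    (h : ∀ a, strand deg a p = strand deg a q) : p = q :=
  sub_eq_zero.1 (eq_zero_of_strand (deg := deg) fun a => by rw [map_sub, h, sub_self])

theorem finite_strand_ne_zero (deg : J → σ →₀ ℕ) (p : J →₀ MvPolynomial σ k) :
    {a | strand deg a p ≠ 0}.Finite := by
  classical
  refine (p.support.biUnion fun b => (p b * monomial (deg b) 1).support).finite_toSet.subset ?_
  intro a ha
  obtain ⟨b, hb⟩ := Finsupp.ne_iff.1 ha
  rw [strand_apply, Finsupp.zero_apply] at hb
  simp only [Finset.coe_biUnion, Set.mem_iUnion]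
  refine ⟨b, ?_, mem_support_iff.2 hb⟩
  rw [Finset.mem_coe, Finsupp.mem_support_iff]
  intro h
  simp [h] at hb

/-- `D` is the matrix of scalars of the homogeneous map `d`. -/
def IsDehomogenization (deg' : J' → σ →₀ ℕ) (deg : J → σ →₀ ℕ)
    (d : (J' →₀ MvPolynomial σ k) →ₗ[MvPolynomial σ k] (J →₀ MvPolynomial σ k))
    (D : (J' →₀ k) →ₗ[k] (J →₀ k)) : Prop :=
  ∀ b' b, d (Finsupp.single b' 1) b * monomial (deg b) 1 =
    monomial (deg' b') (D (Finsupp.single b' 1) b)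

variable {deg' : J' → σ →₀ ℕ} {deg : J → σ →₀ ℕ}
  {d : (J' →₀ MvPolynomial σ k) →ₗ[MvPolynomial σ k] (J →₀ MvPolynomial σ k)}
  {D : (J' →₀ k) →ₗ[k] (J →₀ k)}

theorem exists_isDehomogenization
    (h : ∀ b' b, ∃ c : k, d (Finsupp.single b' 1) b * monomial (deg b) 1 = monomial (deg' b') c) :
    ∃ D, IsDehomogenization deg' deg d D := by
  classical
  refine ⟨Finsupp.linearCombination k fun b' => strand deg (deg' b') (d (Finsupp.single b' 1)),
    fun b' b => ?_⟩
  obtain ⟨c, hc⟩ := h b' b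
  rw [Finsupp.linearCombination_single, one_smul, strand_apply, hc, coeff_monomial, if_pos rfl]

theorem strand_single (b : J) (q : MvPolynomial σ k) (a : σ →₀ ℕ) :
    strand deg a (Finsupp.single b q) = Finsupp.single b (coeff a (q * monomial (deg b) 1)) := by
  ext b'
  rw [strand_apply]
  by_cases h : b' = b
  · rw [h, Finsupp.single_eq_same, Finsupp.single_eq_same]
  · simp [Finsupp.single_eq_of_ne h]

/-- This identity reduces exactness over the polynomial ring to exactness of each strand. -/
theorem IsDehomogenization.strand_map (h : IsDehomogenization deg' deg d D) (a : σ →₀ ℕ)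
    (p : J' →₀ MvPolynomial σ k) : strand deg a (d p) = D (strand deg' a p) := by
  classical
  induction p using Finsupp.induction_linear with
  | zero => simp
  | add p q hp hq => simp only [map_add, hp, hq]
  | single b' q =>
    ext b
    have e : d (Finsupp.single b' q) = q • d (Finsupp.single b' 1) := by
      rw [← map_smul, Finsupp.smul_single, smul_eq_mul, mul_one]
    have e' : D (strand deg' a (Finsupp.single b' q)) =
        coeff a (q * monomial (deg' b') 1) • D (Finsupp.single b' 1) := by
      rw [strand_single, ← map_smul, Finsupp.smul_single, smul_eq_mul, mul_one]
    rw [e, e', strand_apply, Finsupp.smul_apply, Finsupp.smul_apply, smul_eq_mul, smul_eq_mul,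
      mul_assoc, h b' b, coeff_mul_monomial', coeff_mul_monomial']
    split_ifs <;> simp

theorem IsDehomogenization.map_mem (h : IsDehomogenization deg' deg d D) {a : σ →₀ ℕ}
    {x : J' →₀ k} (hx : x ∈ degreeLE k Set.univ deg' a) : D x ∈ degreeLE k Set.univ deg a := by
  rw [← strand_homogenize_self hx, ← h.strand_map]
  exact strand_mem _ _ _

theorem IsDehomogenization.map_homogenize (h : IsDehomogenization deg' deg d D) {a : σ →₀ ℕ}
    {x : J' →₀ k} (hx : x ∈ degreeLE k Set.univ deg' a) :
    d (homogenize deg' a x) = homogenize deg a (D x) := by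
  classical
  refine eq_of_strand (deg := deg) fun a' => ?_
  rw [h.strand_map, strand_homogenize hx, strand_homogenize (h.map_mem hx)]
  split_ifs <;> simp

/-- An element with strands in the range of the matrix of scalars lies in the range. -/
theorem IsDehomogenization.mem_range (h : IsDehomogenization deg' deg d D)
    {p : J →₀ MvPolynomial σ k}
    (hp : ∀ a, ∃ y ∈ degreeLE k Set.univ deg' a, D y = strand deg a p) :
    ∃ q, d q = p := by
  classical
  choose y hy hDy using hp
  let A := (finite_strand_ne_zero deg p).toFinset
  refine ⟨∑ a ∈ A, homogenize deg' a (y a), eq_of_strand (deg := deg) fun a => ?_⟩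
  rw [h.strand_map, map_sum, Finset.sum_congr rfl fun a' _ => strand_homogenize (hy a') a,
    Finset.sum_ite_eq']
  split_ifs with ha
  · exact hDy a
  · simp only [A, Set.Finite.mem_toFinset, Set.mem_ofPred_eq, not_not] at ha
    rw [ha, map_zero]

/-- The homogeneous map with a given matrix of scalars. -/
noncomputable def homogenizeMap (deg' : J' → σ →₀ ℕ) (deg : J → σ →₀ ℕ)
    (D : (J' →₀ k) →ₗ[k] (J →₀ k)) :
    (J' →₀ MvPolynomial σ k) →ₗ[MvPolynomial σ k] (J →₀ MvPolynomial σ k) :=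
  Finsupp.linearCombination _ fun b' => homogenize deg (deg' b') (D (Finsupp.single b' 1))

theorem isDehomogenization_homogenizeMap
    (h : ∀ a, ∀ x ∈ degreeLE k Set.univ deg' a, D x ∈ degreeLE k Set.univ deg a) :
    IsDehomogenization deg' deg (homogenizeMap deg' deg D) D := by
  intro b' b
  rw [homogenizeMap, Finsupp.linearCombination_single, one_smul]
  exact homogenize_apply_mul (h _ _ (single_mem_degreeLE (Set.mem_univ _) le_rfl 1)) b

/-- The homogeneous map to the polynomial ring with given scalars. -/
noncomputable def homogenizeAug (deg : J → σ →₀ ℕ) (ε : (J →₀ k) →ₗ[k] k) :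
    (J →₀ MvPolynomial σ k) →ₗ[MvPolynomial σ k] MvPolynomial σ k :=
  Finsupp.linearCombination _ fun b => monomial (deg b) (ε (Finsupp.single b 1))

theorem coeff_homogenizeAug (deg : J → σ →₀ ℕ) (ε : (J →₀ k) →ₗ[k] k) (a : σ →₀ ℕ)
    (p : J →₀ MvPolynomial σ k) : coeff a (homogenizeAug deg ε p) = ε (strand deg a p) := by
  classical
  induction p using Finsupp.induction_linear with
  | zero => simp
  | add p q hp hq => simp only [map_add, coeff_add, hp, hq]
  | single b q =>
    have e : ε (strand deg a (Finsupp.single b q)) =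
        coeff a (q * monomial (deg b) 1) • ε (Finsupp.single b 1) := by
      rw [strand_single, ← map_smul, Finsupp.smul_single, smul_eq_mul, mul_one]
    rw [e, homogenizeAug, Finsupp.linearCombination_single, smul_eq_mul, smul_eq_mul,
      coeff_mul_monomial', coeff_mul_monomial']
    split_ifs <;> simp

end Dehomogenization

/-! ### Dominant generators and the strands of resolutions of `S/M` -/

namespace MonomialIdeal

open MvPolynomial

variable {σ : Type v} {k : Type u} [Field k]

/-- A dominant generator belongs to each set of generators whose least common multiple it
divides. -/
theorem IsDominant.mem_of_le_sup {G : Finset (σ →₀ ℕ)} {d : σ →₀ ℕ} (hd : IsDominant G d)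
    {g : σ →₀ ℕ} (hg : g ∈ G) (hgd : g ≠ d) {s : Finset (σ →₀ ℕ)} (hs : s ⊆ G)
    (h : d ≤ s.sup id) : d ∈ s := by
  by_contra hds
  obtain ⟨x, hx⟩ := hd
  -- The second generator `g` makes this exponent positive, which settles the empty set, whose lcm
  -- has exponent `0`.
  have hpos : 0 < d x := (Nat.zero_le _).trans_lt (hx g hg hgd)
  have key : ∀ t : Finset (σ →₀ ℕ), (∀ m ∈ t, m x < d x) → t.sup id x < d x := by
    classical
    intro t
    induction t using Finset.induction_on with
    | empty => exact fun _ => hpos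
    | insert m t _ ih =>
      intro ht
      rw [Finset.sup_insert, Finsupp.sup_apply]
      exact max_lt (ht m (Finset.mem_insert_self _ _))
        (ih fun m' hm' => ht m' (Finset.mem_insert_of_mem hm'))
  exact absurd (h x) (not_le.2 (key s fun m hm => hx m (hs hm) fun e => hds (e ▸ hm)))

variable [Finite σ] {M : Ideal (MvPolynomial σ k)}

/-- The exponents of the monomials of a monomial ideal. -/
def exponents (M : Ideal (MvPolynomial σ k)) : Set (σ →₀ ℕ) :=
  {a | ∃ g ∈ minimalGenerators M, g ≤ a}

theorem mem_iff_coeff (hM : IsMonomialIdeal M) {p : MvPolynomial σ k} :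
    p ∈ M ↔ ∀ a ∉ exponents M, coeff a p = 0 := by
  conv_lhs => rw [← span_minimalGenerators hM]
  rw [mem_ideal_span_monomial_image]
  refine forall_congr' fun a => ?_
  rw [mem_support_iff, not_imp_comm]
  rfl

namespace MultigradedFreeResolution

/-- The strands of a multigraded free resolution. -/
theorem exists_strandResolution (hM : IsMonomialIdeal M) (h0 : 0 ∉ exponents M)
    (F : MultigradedFreeResolution M) :
    ∃ (R : StrandResolution.{u, v, 0} k (exponents M)) (e : ∀ i, F.ι i ≃ R.cell i),
      (∀ i, R.active i = Set.univ) ∧ (∀ i b, R.deg i (e i b) = F.mdeg i b) ∧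
      (F.IsMinimal → R.IsMinimal) := by
  classical
  choose D hD using fun i => exists_isDehomogenization (F.d_homogeneous i)
  choose c hc using F.aug_homogeneous
  let ε : (F.ι 0 →₀ k) →ₗ[k] k := Finsupp.linearCombination k c
  have haug : ∀ p, F.aug p = Ideal.Quotient.mk M (homogenizeAug (F.mdeg 0) ε p) := by
    have : F.aug = M.mkQ ∘ₗ homogenizeAug (F.mdeg 0) ε := by
      refine Finsupp.lhom_ext' fun b => LinearMap.ext_ring ?_
      simp only [LinearMap.comp_apply, Finsupp.lsingle_apply, homogenizeAug,
        Finsupp.linearCombination_single, one_smul, hc, ε]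
      rfl
    intro p
    rw [this]
    rfl
  have haug0 : ∀ p, F.aug p = 0 ↔ ∀ a ∉ exponents M, ε (strand (F.mdeg 0) a p) = 0 := by
    intro p
    rw [haug, Ideal.Quotient.eq_zero_iff_mem, mem_iff_coeff hM]
    simp only [coeff_homogenizeAug]
  refine ⟨{ cell := F.ι
            active := fun _ => Set.univ
            deg := F.mdeg
            D := D
            aug := ε
            D_mem := fun i a x hx => (hD i).map_mem hx
            D_D := fun i a x hx => ?_
            aug_D := fun a ha x hx => ?_
            exact_succ := fun i a x hx h => ?_
            exact_zero := fun a x hx h => ?_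
            exists_aug_eq_one := ?_ }, fun i => Equiv.refl _, fun i => rfl, fun i b => rfl, ?_⟩
  · rw [← strand_homogenize_self hx, ← (hD (i + 1)).strand_map, ← (hD i).strand_map,
      (F.exact_succ i).apply_apply_eq_zero, map_zero]
  · have := (haug0 _).1 (F.exact_zero.apply_apply_eq_zero (homogenize (F.mdeg 1) a x)) a ha
    rwa [(hD 0).strand_map, strand_homogenize_self hx] at this
  · have h1 : F.d i (homogenize (F.mdeg (i + 1)) a x) = 0 := by
      rw [(hD i).map_homogenize hx, h]
      ext1 b
      simp [homogenize_apply]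
    obtain ⟨q, hq⟩ := (F.exact_succ i _).1 h1
    refine ⟨strand _ a q, strand_mem _ _ _, ?_⟩
    rw [← (hD (i + 1)).strand_map, hq, strand_homogenize_self hx]
  · have h1 : F.aug (homogenize (F.mdeg 0) a x) = 0 := by
      rw [haug0]
      intro a' ha'
      rw [strand_homogenize hx]
      split_ifs with e
      · subst e
        exact h.resolve_left ha'
      · exact map_zero _
    obtain ⟨q, hq⟩ := (F.exact_zero _).1 h1
    refine ⟨strand _ a q, strand_mem _ _ _, ?_⟩
    rw [← (hD 0).strand_map, hq, strand_homogenize_self hx]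
  -- The strand of degree `0` of a preimage of `1` works: as `0` is not an exponent of `M`, constant
  -- coefficients are well defined modulo `M`.
  · obtain ⟨p, hp⟩ := F.aug_surjective (Ideal.Quotient.mk M 1)
    refine ⟨strand _ 0 p, strand_mem _ _ _, ?_⟩
    rw [haug, Ideal.Quotient.mk_eq_mk_iff_sub_mem, mem_iff_coeff hM] at hp
    have := hp 0 h0
    rw [coeff_sub, coeff_homogenizeAug, coeff_zero_one, sub_eq_zero] at this
    exact this
  · intro hF i b _ b' _ hbb'
    by_contra hne
    change F.mdeg i b' = F.mdeg (i + 1) b at hbb'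
    change D i (Finsupp.single b 1) b' ≠ 0 at hne
    refine hF i b b' ?_
    have h1 := hD i b b'
    rw [hbb', ← mul_one (D i (Finsupp.single b 1) b'), ← C_mul_monomial] at h1
    have h2 : monomial (F.mdeg (i + 1) b) (1 : k) ≠ 0 := by simp
    rw [mul_right_cancel₀ h2 h1]
    -- A nonzero scalar between cells of equal degree is itself the matrix entry, hence a unit.
    exact (isUnit_iff_ne_zero.2 hne).map C

/-- The multigraded free resolution with given strands. -/
theorem exists_of_strandResolution (hM : IsMonomialIdeal M)
    (R : StrandResolution.{u, v, 0} k (exponents M)) (hfin : ∀ i, Finite (R.cell i))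
    (hact : ∀ i, R.active i = Set.univ) (hR : R.IsMinimal) :
    ∃ F : MultigradedFreeResolution M, F.IsMinimal := by
  classical
  have hle : ∀ i a, R.le i a = degreeLE k Set.univ (R.deg i) a := fun i a => by
    rw [StrandResolution.le, hact]
  have hdeh : ∀ i, IsDehomogenization (R.deg (i + 1)) (R.deg i)
      (homogenizeMap (R.deg (i + 1)) (R.deg i) (R.D i)) (R.D i) := fun i =>
    isDehomogenization_homogenizeMap fun a x hx => by
      rw [← hle] at hx ⊢
      exact R.D_mem i a x hx
  have hstrand : ∀ i a p, strand (R.deg i) a p ∈ R.le i a := fun i a p => by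
    rw [hle]
    exact strand_mem _ _ _
  have haug0 : ∀ p, (M.mkQ ∘ₗ homogenizeAug (R.deg 0) R.aug) p = 0 ↔
      ∀ a ∉ exponents M, R.aug (strand (R.deg 0) a p) = 0 := by
    intro p
    rw [LinearMap.comp_apply, Submodule.mkQ_apply, Submodule.Quotient.mk_eq_zero, mem_iff_coeff hM]
    simp only [coeff_homogenizeAug]
  refine ⟨{ ι := R.cell
            finite_ι := hfin
            mdeg := R.deg
            d := fun i => homogenizeMap (R.deg (i + 1)) (R.deg i) (R.D i)
            aug := M.mkQ ∘ₗ homogenizeAug (R.deg 0) R.aug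
            d_homogeneous := fun i b b' => ⟨_, hdeh i b b'⟩
            aug_homogeneous := fun b => ⟨R.aug (Finsupp.single b 1), ?_⟩
            aug_surjective := ?_
            exact_zero := fun p => ?_
            exact_succ := fun i p => ?_ }, fun i b b' hunit => ?_⟩
  · rw [LinearMap.comp_apply, homogenizeAug, Finsupp.linearCombination_single, one_smul]
    rfl
  · obtain ⟨u, hu, hu1⟩ := R.exists_aug_eq_one
    replace hu : u ∈ degreeLE k Set.univ (R.deg 0) ⊥ := by rwa [← hle]
    have h1 : homogenizeAug (R.deg 0) R.aug (homogenize (R.deg 0) ⊥ u) = 1 := by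
      ext a
      rw [coeff_homogenizeAug, strand_homogenize hu, coeff_one]
      change R.aug (if 0 = a then u else 0) = _
      split_ifs
      · exact hu1
      · exact map_zero _
    intro y
    obtain ⟨q, rfl⟩ := M.mkQ_surjective y
    refine ⟨q • homogenize (R.deg 0) ⊥ u, ?_⟩
    rw [LinearMap.comp_apply, map_smul, h1, smul_eq_mul, mul_one]
  · rw [haug0]
    constructor
    · intro h
      refine (hdeh 0).mem_range fun a => ?_
      rw [← hle]
      exact R.exact_zero a _ (hstrand 0 a p) (or_iff_not_imp_left.2 (h a))
    · rintro ⟨q, rfl⟩ a ha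
      rw [(hdeh 0).strand_map]
      exact R.aug_D a ha _ (hstrand 1 a q)
  · constructor
    · intro h
      refine (hdeh (i + 1)).mem_range fun a => ?_
      rw [← hle]
      refine R.exact_succ i a _ (hstrand (i + 1) a p) ?_
      rw [← (hdeh i).strand_map, h, map_zero]
    · rintro ⟨q, rfl⟩
      refine eq_zero_of_strand (deg := R.deg i) fun a => ?_
      rw [(hdeh i).strand_map, (hdeh (i + 1)).strand_map]
      exact R.D_D i a _ (hstrand (i + 2) a q)
  · change IsUnit (homogenizeMap (R.deg (i + 1)) (R.deg i) (R.D i) (Finsupp.single b 1) b') at hunit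
    rw [homogenizeMap, Finsupp.linearCombination_single, one_smul, homogenize_apply] at hunit
    -- A unit has nonzero constant coefficient, so the truncated difference of degrees is zero; with
    -- homogeneity the degrees agree, against minimality.
    have h1 := (hunit.map constantCoeff).ne_zero
    rw [constantCoeff_monomial] at h1
    split_ifs at h1 with h2
    · have hb : Finsupp.single b (1 : k) ∈ R.le (i + 1) (R.deg (i + 1) b) :=
        single_mem_degreeLE (by simp [hact]) le_rfl 1
      have h3 := (mem_degreeLE.1 (R.D_mem i _ _ hb) b' h1).2
      exact h1 (hR i b (by simp [hact]) b' (by simp [hact])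
        (le_antisymm h3 (tsub_eq_zero_iff_le.1 h2)))
    · exact h1 rfl

end MultigradedFreeResolution

theorem eq_of_le_of_mem_minimalGenerators {a b : σ →₀ ℕ} (ha : a ∈ minimalGenerators M)
    (hb : b ∈ minimalGenerators M) (h : a ≤ b) : a = b := by
  have ha' : Minimal (fun b => monomial b (1 : k) ∈ M) a := by simpa [minimalGenerators] using ha
  have hb' : Minimal (fun b => monomial b (1 : k) ∈ M) b := by simpa [minimalGenerators] using hb
  exact le_antisymm h (hb'.2 ha'.1 h)

theorem isUpperSet_exponents : IsUpperSet (exponents M) :=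
  fun _ _ hab ⟨g, hg, hga⟩ => ⟨g, hg, hga.trans hab⟩

end MonomialIdeal

/-! ### The 2-semidominant case -/

open MonomialIdeal in
theorem mainTheorem7 {σ k : Type*} [Finite σ] [Field k] (M : Ideal (MvPolynomial σ k))
    (hM : MonomialIdeal.IsMonomialIdeal M) (h2 : MonomialIdeal.IsSemidominant 2 M) :
    MonomialIdeal.HasCharacteristicBettiNumbersInMinimalHomologicalDegrees M := by
  classical
  obtain ⟨p, q, hpq, hfil⟩ := Finset.card_eq_two.1 h2
  have hmem : ∀ m, (m ∈ minimalGenerators M ∧ ¬ IsDominant (minimalGenerators M) m) ↔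
      m = p ∨ m = q := by
    intro m
    have := Finset.ext_iff.1 hfil m
    simpa using this
  have hp := ((hmem p).2 (Or.inl rfl)).1
  have hq := ((hmem q).2 (Or.inr rfl)).1
  -- If `1` were in `M`, a generator dividing `1` would equal both `p` and `q`.
  have h0 : (0 : σ →₀ ℕ) ∉ exponents M := by
    rintro ⟨g, hg, hg0⟩
    have hgp := eq_of_le_of_mem_minimalGenerators hg hp (hg0.trans zero_le)
    have hgq := eq_of_le_of_mem_minimalGenerators hg hq (hg0.trans zero_le)
    exact hpq (hgp.symm.trans hgq)
  -- Members other than `p` and `q` are dominant, hence forced by the lcm.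
  have hsub : ∀ s ⊆ minimalGenerators M, ∀ s' ⊆ minimalGenerators M, s.sup id = s'.sup id →
      (s.erase p).erase q ⊆ (s'.erase p).erase q := by
    intro s hs s' hs' h d hd
    simp only [Finset.mem_erase] at hd ⊢
    refine ⟨hd.1, hd.2.1, ?_⟩
    have hdom : IsDominant (minimalGenerators M) d := by
      by_contra hnd
      rcases (hmem d).1 ⟨hs hd.2.2, hnd⟩ with e | e
      · exact hd.2.1 e
      · exact hd.1 e
    exact hdom.mem_of_le_sup hp (Ne.symm hd.2.1) hs' (h ▸ Finset.le_sup (f := id) hd.2.2)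
  refine ⟨?_, fun F hF i l => ?_⟩
  -- The lcm of all generators bounds the degrees needed: a generator divides `a` exactly when it
  -- divides `a ⊓ L`.
  · obtain ⟨R, hR, hfin, hact⟩ := StrandResolution.exists_minimal (k := k) (U := exponents M)
      (L := (minimalGenerators M).sup id) (Set.finite_Iic _) isUpperSet_exponents
      (fun a ⟨g, hg, hga⟩ => ⟨g, hg, le_inf hga (Finset.le_sup (f := id) hg)⟩) h0
    exact MultigradedFreeResolution.exists_of_strandResolution hM R hfin hact hR
  · obtain ⟨R, e, hact, hdeg, hmin⟩ := F.exists_strandResolution hM h0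
    have key := (hmin hF).cells_of_differ_in_two (l := l) hp hq hpq
      (fun s hs s' hs' h h' => by
        convert (hsub s hs s' hs' (h.trans h'.symm)).antisymm
          (hsub s' hs' s hs (h'.trans h.symm))) i
    have hcard : F.count i l = Nat.card {b // R.deg i b = l} :=
      Nat.card_congr ((e i).subtypeEquiv fun b => by rw [hdeg])
    rw [hcard]
    dsimp only
    split_ifs with hi
    · have hi' := hi
      unfold oddMultidegrees minHomologicalDegree taylorSymbols at hi'
      rw [Set.mem_ofPred_eq] at hi'
      rw [if_pos (by convert hi')] at key
      obtain ⟨b, ⟨-, hb⟩, huniq⟩ := key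
      rw [Nat.card_eq_one_iff_unique]
      refine ⟨⟨fun x y => Subtype.ext ?_⟩, ⟨⟨b, hb⟩⟩⟩
      rw [huniq x ⟨by simp [hact], x.2⟩, huniq y ⟨by simp [hact], y.2⟩]
    · have hi' := hi
      unfold oddMultidegrees minHomologicalDegree taylorSymbols at hi'
      rw [Set.mem_ofPred_eq] at hi'
      rw [if_neg (by convert hi')] at key
      have : IsEmpty {b // R.deg i b = l} := ⟨fun b => key ⟨b.1, by simp [hact], b.2⟩⟩
      exact Nat.card_of_isEmpty
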